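/- A \emph{covering system} is a finite set of arithmetic progressions (residue classes $r \bmod q$ with $q\ge 1$) whose union is $\mathbb{Z}$; it is \emph{minimal} if no proper subset of its arithmetic progressions also covers $\mathbb{Z}$. There exists an absolute constant $c>0$ with the following properties. For every minimal covering system whose moduli are pairwise distinct, and for every $j\ge 1$ not exceeding the number of its progressions, the $j$-th smallest modulus is at most $$\exp\!\left(\frac{c\,j^2}{\log(j+1)}\right).$$ In particular (case $j=1$), the smallest modulus of every covering system with pairwise distinct moduli, minimal or not, is at most $\exp(c/\log 2)$; this recovers Hough's theorem that the minimum modulus is bounded. -/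

import Mathlib

/-- An arithmetic progression in `ℤ`: a residue class modulo a positive integer.  Since the residue
is an element of `ZMod modulus`, each arithmetic progression is represented exactly once. -/
structure ArithProg where
  /-- The modulus (common difference). -/
  modulus : ℕ
  modulus_pos : 0 < modulus
  /-- The residue class. -/
  residue : ZMod modulus

/-- The set of integers belonging to an arithmetic progression. -/
def ArithProg.toSet (A : ArithProg) : Set ℤ :=
  {n : ℤ | (n : ZMod A.modulus) = A.residue}

/-- A covering system is a finite set of arithmetic progressions whose union is `ℤ`. -/
def IsCoveringSystem (C : Finset ArithProg) : Prop :=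
  ⋃ A ∈ C, A.toSet = Set.univ

/-- A covering system is minimal if no proper subset of its arithmetic progressions also
covers `ℤ`. -/
def IsMinimalCoveringSystem (C : Finset ArithProg) : Prop :=
  IsCoveringSystem C ∧ ∀ D : Finset ArithProg, D ⊂ C → ¬ IsCoveringSystem D

/-- The members of the system have pairwise distinct moduli. -/
def HasDistinctModuli (C : Finset ArithProg) : Prop :=
  ∀ A ∈ C, ∀ B ∈ C, A.modulus = B.modulus → A = B

/-- The finite set of moduli of a system. -/
def moduli (C : Finset ArithProg) : Finset ℕ :=
  C.image ArithProg.modulus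

/-- `q` is the `j`-th smallest modulus of the system (counting from `j = 1`): it is one of the
moduli, and exactly `j` of the moduli are at most `q`. -/
def IsJthSmallestModulus (C : Finset ArithProg) (j q : ℕ) : Prop :=
  q ∈ moduli C ∧ ((moduli C).filter (fun d => d ≤ q)).card = j

/-!
The argument is the distortion method of Balister, Bollobás, Morris, Sahasrabudhe and Tiba.

Let `q` be the `j`-th smallest modulus. By minimality the `j - 1` progressions with smaller moduli
leave some integer uncovered. The same then holds for those of them whose moduli are `y`-smooth, so
they leave a set of density at least `2 ^ (1 - j)` uncovered (`le_mean_uncovered`): the product of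
`1 - ζ_d ^ (n - a_d)`, with `ζ_d` a primitive `d`-th root of unity, vanishes exactly when `n` is
covered, and it is an exponential sum with `2 ^ (j - 1)` frequencies, so it cannot vanish at
`2 ^ (j - 1)` consecutive integers without vanishing at all later ones. It remains to see that, for
`y = 4 ^ (b j)` with a suitable constant `b`, the other progressions cannot cover this set when `q`
is too large.

* For progressions with a modulus that has a prime factor `p ≥ y`, the uniform measure is distorted,
  one prime at a time and in increasing order (`IsControlledDensity.exists_distortion`). On each
  fibre of `ℤ / M p ^ e → ℤ / M`, where `M` collects the smaller primes, the density is shifted away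
  from the progressions whose modulus divides `M p ^ e` but not `M`, by a factor that is at most `2`
  and has mean `1` on the fibre. This gives those progressions a mass of at most `T / (p - 1) ^ 2`,
  where `T` bounds a second moment that grows by a factor of at most `1 + 64 / p` per prime. Later
  steps change neither these masses nor the measure of sets that are periodic modulo the `y`-smooth
  part. As `∏_{p < x} (1 + 64 / p) = O(√x)`, the total mass is `O(1 / √y)`, less than `2 ^ (-j)`
  (`exists_sum_momentBound_le`).
* The progressions with a `y`-smooth modulus at least `q` keep their density `1 / d`. By Rankin's
  trick with the exponent `σ = log (j + 1) / (4 b j)`, these densities add up to at most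
  `q ^ (-σ) exp (O(j))`, which is less than `2 ^ (-j)` once `q > exp (c j ^ 2 / log (j + 1))` with a
  large constant `c` (`sum_inv_smoothNumbers_lt`).

The two masses add up to less than `2 ^ (1 - j)`, so the progressions do not cover.
-/

open Finset

/-! ### Means and residue classes -/

/-- The mean of a function on the integers `0, …, Q - 1`; for a `Q`-periodic function this is its
mean over `ℤ`. -/
noncomputable def mean (Q : ℕ) (f : ℤ → ℝ) : ℝ :=
  (∑ x ∈ range Q, f (x : ℤ)) / Q

/-- The real-valued indicator function of the residue class `a` modulo `d`. -/
noncomputable def classInd (d : ℕ) (a x : ℤ) : ℝ :=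
  if (d : ℤ) ∣ x - a then 1 else 0

/-- The average of `g` over the fibre `x, x + M, …, x + (q - 1) M`. -/
noncomputable def fibreMean (M q : ℕ) (g : ℤ → ℝ) (x : ℤ) : ℝ :=
  mean q fun t => g (x + M * t)

lemma Function.Periodic.of_natCast_dvd {f : ℤ → ℝ} {M Q : ℕ} (hf : Function.Periodic f (M : ℤ))
    (h : M ∣ Q) : Function.Periodic f (Q : ℤ) := by
  obtain ⟨k, rfl⟩ := h
  have := hf.nat_mul k
  push_cast
  rwa [mul_comm]

lemma mean_mono {Q : ℕ} {f g : ℤ → ℝ} (h : ∀ x, f x ≤ g x) : mean Q f ≤ mean Q g := by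
  unfold mean
  gcongr
  exact h _

lemma mean_nonneg {Q : ℕ} {f : ℤ → ℝ} (h : ∀ x, 0 ≤ f x) : 0 ≤ mean Q f :=
  div_nonneg (sum_nonneg fun _ _ => h _) (Nat.cast_nonneg _)

lemma mean_add (Q : ℕ) (f g : ℤ → ℝ) : mean Q (fun x => f x + g x) = mean Q f + mean Q g := by
  simp [mean, sum_add_distrib, add_div]

lemma mean_sub (Q : ℕ) (f g : ℤ → ℝ) : mean Q (fun x => f x - g x) = mean Q f - mean Q g := by
  simp [mean, sum_sub_distrib, sub_div]

lemma mean_const_mul (Q : ℕ) (c : ℝ) (f : ℤ → ℝ) : mean Q (fun x => c * f x) = c * mean Q f := by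
  simp [mean, ← mul_sum, mul_div_assoc]

lemma mean_sum {ι : Type*} (Q : ℕ) (s : Finset ι) (f : ι → ℤ → ℝ) :
    mean Q (fun x => ∑ i ∈ s, f i x) = ∑ i ∈ s, mean Q (f i) := by
  simp only [mean, sum_div]
  rw [sum_comm]

lemma mean_const {Q : ℕ} (hQ : 0 < Q) (c : ℝ) : mean Q (fun _ => c) = c := by
  have : (Q : ℝ) ≠ 0 := by positivity
  simp [mean]
  field_simp

lemma mean_shift {Q : ℕ} {f : ℤ → ℝ} (hf : Function.Periodic f (Q : ℤ)) (m : ℕ) :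
    mean Q (fun x => f (x + m)) = mean Q f := by
  induction m with
  | zero => simp
  | succ m ih =>
    rw [← ih]
    have hper : f ((Q : ℤ) + m) = f m := by rw [add_comm]; exact hf _
    have h1 := sum_range_succ (fun x : ℕ => f ((x : ℤ) + m)) Q
    have h2 := sum_range_succ' (fun x : ℕ => f ((x : ℤ) + m)) Q
    have h3 : ∑ x ∈ range Q, f ((x : ℤ) + ((m + 1 : ℕ) : ℤ))
        = ∑ x ∈ range Q, f (((x + 1 : ℕ) : ℤ) + m) :=
      sum_congr rfl fun x _ => by push_cast; congr 1; ring
    simp only [mean]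
    rw [h3]
    congr 1
    simp only [Nat.cast_zero, zero_add] at h2
    linarith

lemma classInd_nonneg (d : ℕ) (a x : ℤ) : 0 ≤ classInd d a x := by
  unfold classInd; split_ifs <;> norm_num

lemma classInd_le_one (d : ℕ) (a x : ℤ) : classInd d a x ≤ 1 := by
  unfold classInd; split_ifs <;> norm_num

lemma classInd_periodic (d : ℕ) (a : ℤ) : Function.Periodic (classInd d a) (d : ℤ) := by
  intro x
  have : x + (d : ℤ) - a = (x - a) + d := by ring
  simp only [classInd, this, dvd_add_self_right]

lemma classInd_mul {m n : ℕ} (h : m.Coprime n) (a x : ℤ) :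
    classInd (m * n) a x = classInd m a x * classInd n a x := by
  have hc : IsCoprime (m : ℤ) (n : ℤ) := Nat.isCoprime_iff_coprime.mpr h
  have : ((m * n : ℕ) : ℤ) ∣ x - a ↔ (m : ℤ) ∣ x - a ∧ (n : ℤ) ∣ x - a := by
    push_cast
    exact ⟨fun hd => ⟨(Dvd.intro _ rfl).trans hd, (Dvd.intro_left _ rfl).trans hd⟩,
      fun hd => hc.mul_dvd hd.1 hd.2⟩
  simp only [classInd, this]
  by_cases h1 : (m : ℤ) ∣ x - a <;> by_cases h2 : (n : ℤ) ∣ x - a <;> simp [h1, h2]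

/-- Among `d` terms of a progression whose difference is coprime to `d`, at most one lies in a
given class modulo `d`. -/
lemma sum_classInd_le_one {d M : ℕ} (h : d.Coprime M) (a x : ℤ) :
    ∑ t ∈ range d, classInd d a (x + M * t) ≤ 1 := by
  simp only [classInd]
  rw [sum_boole]
  norm_cast
  rw [card_le_one]
  intro s hs t ht
  simp only [mem_filter, mem_range] at hs ht
  have h1 : (d : ℤ) ∣ M * ((s : ℤ) - t) := by
    have := dvd_sub hs.2 ht.2
    ring_nf at this ⊢
    exact this
  have h2 : (d : ℤ) ∣ (s : ℤ) - t :=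
    (Nat.isCoprime_iff_coprime.mpr h).dvd_of_dvd_mul_left h1
  have h3 : t ≡ s [MOD d] := (Nat.modEq_iff_dvd).mpr h2
  exact (Nat.ModEq.eq_of_lt_of_lt h3 ht.1 hs.1).symm

/-- If `d` successive translates of `G` by a period of `F` add up to at most `1`, then multiplying
by `G` shrinks the mean of `F` by the factor `d`. -/
lemma mean_mul_le_of_sum_shift_le {Q M d : ℕ} {F G : ℤ → ℝ} (hM : M ∣ Q)
    (hF0 : ∀ x, 0 ≤ F x) (hF : Function.Periodic F (M : ℤ)) (hG : Function.Periodic G (Q : ℤ))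
    (hd : 0 < d) (hsum : ∀ x, ∑ t ∈ range d, G (x + M * t) ≤ 1) :
    mean Q (fun x => F x * G x) ≤ mean Q F / d := by
  have hFQ := hF.of_natCast_dvd hM
  have hFG : Function.Periodic (fun x => F x * G x) (Q : ℤ) := fun x => by
    simp only [hFQ x, hG x]
  have hshift : ∀ t ∈ range d, mean Q (fun x => F x * G (x + M * t)) =
      mean Q (fun x => F x * G x) := by
    intro t _
    rw [← mean_shift hFG (M * t)]
    have h1 : ∀ x, F (x + ((M * t : ℕ) : ℤ)) = F x :=
      fun x => (hF.of_natCast_dvd (Dvd.intro t rfl)) x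
    simp only [h1]
    push_cast
    rfl
  rw [le_div_iff₀ (by positivity)]
  calc mean Q (fun x => F x * G x) * d
      = ∑ t ∈ range d, mean Q (fun x => F x * G (x + M * t)) := by
        rw [sum_congr rfl hshift]; simp [mul_comm]
    _ = mean Q (fun x => F x * ∑ t ∈ range d, G (x + M * t)) := by
        rw [← mean_sum]; simp only [mul_sum]
    _ ≤ mean Q F := mean_mono fun x => mul_le_of_le_one_right (hF0 x) (hsum x)

lemma mean_mul_classInd_le {Q M d : ℕ} {F : ℤ → ℝ} (hM : M ∣ Q) (hd : d ∣ Q) (hd0 : 0 < d)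
    (h : d.Coprime M) (hF0 : ∀ x, 0 ≤ F x) (hF : Function.Periodic F (M : ℤ)) (a : ℤ) :
    mean Q (fun x => F x * classInd d a x) ≤ mean Q F / d :=
  mean_mul_le_of_sum_shift_le hM hF0 hF ((classInd_periodic d a).of_natCast_dvd hd) hd0
    (sum_classInd_le_one h a)

lemma mean_classInd_le {Q d : ℕ} (hQ : 0 < Q) (hd : d ∣ Q) (a : ℤ) :
    mean Q (classInd d a) ≤ 1 / d := by
  have := mean_mul_classInd_le (F := fun _ => 1) (one_dvd Q) hd (Nat.pos_of_dvd_of_pos hd hQ)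
    (Nat.coprime_one_right d) (fun _ => zero_le_one) (fun _ => rfl) a
  simpa [mean_const hQ] using this

/-! ### Averages over fibres -/

lemma fibreMean_periodic {M q : ℕ} {g : ℤ → ℝ} (hg : Function.Periodic g ((M * q : ℕ) : ℤ)) :
    Function.Periodic (fibreMean M q g) (M : ℤ) := by
  intro x
  have hper : Function.Periodic (fun t : ℤ => g (x + M * t)) (q : ℤ) := by
    intro t
    have := hg (x + M * t)
    push_cast at this
    simp only
    rw [← this]
    congr 1
    ring
  have := mean_shift hper 1
  simp only [fibreMean]
  rw [← this]
  congr 1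
  funext t
  congr 1
  push_cast
  ring

lemma fibreMean_nonneg {M q : ℕ} {g : ℤ → ℝ} (hg : ∀ x, 0 ≤ g x) (x : ℤ) :
    0 ≤ fibreMean M q g x :=
  mean_nonneg fun _ => hg _

lemma fibreMean_mono {M q : ℕ} {f g : ℤ → ℝ} (h : ∀ x, f x ≤ g x) (x : ℤ) :
    fibreMean M q f x ≤ fibreMean M q g x :=
  mean_mono fun _ => h _

/-- A function constant along the fibres can be pulled out of the fibre average. -/
lemma fibreMean_mul {M q : ℕ} {F : ℤ → ℝ} (g : ℤ → ℝ) (hF : Function.Periodic F (M : ℤ)) (x : ℤ) :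
    fibreMean M q (fun y => F y * g y) x = F x * fibreMean M q g x := by
  have h1 : ∀ t : ℤ, F (x + M * t) = F x := fun t => by
    have := hF.int_mul t x
    rwa [Int.cast_id, mul_comm] at this
  simp only [fibreMean, h1, mean_const_mul]

lemma mean_fibreMean {Q M q : ℕ} {g : ℤ → ℝ} (hq : 0 < q) (hg : Function.Periodic g (Q : ℤ)) :
    mean Q (fibreMean M q g) = mean Q g := by
  have h1 : fibreMean M q g = fun x => ∑ t ∈ range q, (1 / (q : ℝ)) * g (x + M * t) := by
    funext x
    simp only [fibreMean, mean, ← mul_sum]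
    ring
  rw [h1, mean_sum]
  have h2 : ∀ t ∈ range q, mean Q (fun x => (1 / (q : ℝ)) * g (x + M * t))
      = 1 / q * mean Q g := by
    intro t _
    rw [mean_const_mul, ← mean_shift hg (M * t)]
    push_cast
    rfl
  have : (q : ℝ) ≠ 0 := by positivity
  rw [sum_congr rfl h2]
  simp
  field_simp

lemma mean_mul_fibreMean {Q M q : ℕ} {F g : ℤ → ℝ} (hN : M * q ∣ Q) (hq : 0 < q)
    (hF : Function.Periodic F (M : ℤ)) (hg : Function.Periodic g ((M * q : ℕ) : ℤ)) :
    mean Q (fun x => F x * g x) = mean Q (fun x => F x * fibreMean M q g x) := by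
  have hF' := hF.of_natCast_dvd ((Dvd.intro q rfl).trans hN)
  have hg' := hg.of_natCast_dvd hN
  have hper : Function.Periodic (fun x => F x * g x) (Q : ℤ) := fun x => by
    simp only [hF' x, hg' x]
  rw [← mean_fibreMean (M := M) hq hper]
  congr 1
  funext x
  exact fibreMean_mul g hF x

lemma fibreMean_classInd_le {M q d : ℕ} (hq : 0 < q) (hd : d ∣ q) (h : d.Coprime M) (a x : ℤ) :
    fibreMean M q (classInd d a) x ≤ 1 / d := by
  have hd0 := Nat.pos_of_dvd_of_pos hd hq
  have hper : Function.Periodic (fun t : ℤ => classInd d a (x + M * t)) (d : ℤ) := by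
    intro t
    have := (classInd_periodic d a).nat_mul M (x + M * t)
    simp only
    rw [← this]
    congr 1
    ring
  have := mean_mul_le_of_sum_shift_le (Q := q) (M := 1) (d := d) (F := fun _ => 1)
    (G := fun t => classInd d a (x + M * t)) (one_dvd q) (fun _ => zero_le_one) (fun _ => rfl)
    (hper.of_natCast_dvd hd) hd0 (fun y => by
      have := sum_classInd_le_one h a (x + M * y)
      refine le_of_eq_of_le (sum_congr rfl fun t _ => ?_) this
      congr 1
      push_cast
      ring)
  simpa [mean_const hq, fibreMean] using this

/-! ### Distorted weights -/

/-- The sum, over the divisors `m` of `M`, of the indicators of the classes `a m` modulo `m`. -/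
noncomputable def divisorClassSum (M : ℕ) (a : ℕ → ℤ) (x : ℤ) : ℝ :=
  ∑ m ∈ M.divisors, classInd m (a m) x

/-- The union of the residue classes `a d` modulo `d`, over `d ∈ D`. -/
def covered (D : Finset ℕ) (a : ℕ → ℤ) : Set ℤ :=
  {x | ∃ d ∈ D, (d : ℤ) ∣ x - a d}

/-- A density `w` on `ℤ / M` (relative to the uniform one), whose second moment against sums of
residue classes, one for each divisor of `M`, is at most `T` for every choice of the classes.
Means are taken modulo a common multiple `Q` of all moduli in play. -/
structure IsControlledDensity (Q M : ℕ) (w : ℤ → ℝ) (T : ℝ) : Prop where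
  nonneg : ∀ x, 0 ≤ w x
  periodic : Function.Periodic w (M : ℤ)
  mean_eq_one : mean Q w = 1
  moment_le : ∀ a b : ℕ → ℤ,
    mean Q (fun x => w x * (divisorClassSum M a x * divisorClassSum M b x)) ≤ T

lemma divisorClassSum_nonneg (M : ℕ) (a : ℕ → ℤ) (x : ℤ) : 0 ≤ divisorClassSum M a x :=
  sum_nonneg fun _ _ => classInd_nonneg _ _ _

lemma covered_indicator_periodic {D : Finset ℕ} {N : ℕ} {a : ℕ → ℤ} (hD : ∀ d ∈ D, d ∣ N) :
    Function.Periodic ((covered D a).indicator (1 : ℤ → ℝ)) (N : ℤ) := by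
  classical
  intro x
  have : x + (N : ℤ) ∈ covered D a ↔ x ∈ covered D a := by
    refine exists_congr fun d => and_congr_right fun hd => ?_
    have h1 : (d : ℤ) ∣ N := Int.natCast_dvd_natCast.mpr (hD d hd)
    rw [show x + (N : ℤ) - a d = (x - a d) + N by ring, dvd_add_left h1]
  simp only [Set.indicator_apply, this, Pi.one_apply]

/-- Splitting a divisor of `M * p ^ e` into its part prime to `p` and its power of `p`. -/
lemma exists_mul_pow_of_dvd {p e M d : ℕ} (hp : p.Prime) (hd : d ∣ M * p ^ e) :
    ∃ m f, m ∣ M ∧ f ≤ e ∧ d = m * p ^ f := by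
  obtain ⟨m, q, hm, hq, rfl⟩ := (Nat.dvd_mul).mp hd
  obtain ⟨f, hf, rfl⟩ := (Nat.dvd_prime_pow hp).mp hq
  exact ⟨m, f, hm, hf, rfl⟩

lemma sum_le_sum_mul_pow {p M : ℕ} (hM : M ≠ 0) (s t : Finset ℕ)
    (hs : ∀ d ∈ s, ∃ m f, m ∣ M ∧ f ∈ t ∧ d = m * p ^ f) (F : ℕ → ℝ) (hF : ∀ d, 0 ≤ F d) :
    ∑ d ∈ s, F d ≤ ∑ f ∈ t, ∑ m ∈ M.divisors, F (m * p ^ f) := by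
  rw [← sum_product' t M.divisors fun f m => F (m * p ^ f)]
  have hsub : s ⊆ (t ×ˢ M.divisors).image fun x => x.2 * p ^ x.1 := by
    intro d hd
    obtain ⟨m, f, hm, hf, h⟩ := hs d hd
    exact mem_image.mpr ⟨(f, m), mem_product.mpr ⟨hf, Nat.mem_divisors.mpr ⟨hm, hM⟩⟩, h.symm⟩
  calc ∑ d ∈ s, F d ≤ ∑ d ∈ (t ×ˢ M.divisors).image fun x => x.2 * p ^ x.1, F d :=
        sum_le_sum_of_subset_of_nonneg hsub fun d _ _ => hF d
    _ ≤ ∑ x ∈ t ×ˢ M.divisors, F (x.2 * p ^ x.1) :=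
        sum_image_le_of_nonneg fun _ _ => hF _

/-- The weights of the pairs of exponents of `p`, in the passage from `M` to `M * p ^ e`, add up
to at most `1 + 64 / p`. -/
lemma sum_pow_max_le {p : ℕ} (hp : p.Prime) (e : ℕ) :
    ∑ i ∈ range (e + 1), ∑ j ∈ range (e + 1),
      (if max i j = 0 then (1 : ℝ) else 2 / (p : ℝ) ^ max i j) ≤ 1 + 64 / p := by
  have hp2 : (2 : ℝ) ≤ p := by exact_mod_cast hp.two_le
  have hgeo : ∑ i ∈ range (e + 1), (3 / 4 : ℝ) ^ i ≤ 4 := by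
    rw [geom_sum_eq (by norm_num)]
    have : (0 : ℝ) < (3 / 4) ^ (e + 1) := by positivity
    rw [div_le_iff_of_neg (by norm_num)]
    linarith
  have hgeo0 : 0 ≤ ∑ i ∈ range (e + 1), (3 / 4 : ℝ) ^ i := sum_nonneg fun _ _ => by positivity
  -- `2 / p ^ k ≤ (4 / p) (1 / 2) ^ k` for `k ≥ 1`, and `1 / 2 ≤ (3 / 4) ^ 2`.
  have hterm : ∀ i j : ℕ, (if max i j = 0 then (1 : ℝ) else 2 / (p : ℝ) ^ max i j) ≤
      (if i = 0 then (if j = 0 then 1 else 0) else 0) +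
        4 / p * ((3 / 4 : ℝ) ^ i * (3 / 4 : ℝ) ^ j) := by
    intro i j
    rcases Nat.eq_zero_or_pos (max i j) with h | h
    · have h1 : i = 0 := by omega
      have h2 : j = 0 := by omega
      subst h1 h2
      simpa using (by positivity : (0 : ℝ) ≤ 4 / p)
    · obtain ⟨k, hk⟩ := Nat.exists_eq_add_of_le h
      have h0 : (if i = 0 then (if j = 0 then (1 : ℝ) else 0) else 0) = 0 := by
        split_ifs <;> first | rfl | (exfalso; simp_all)
      rw [if_neg (by omega), h0, zero_add, ← pow_add]
      have h1 : (2 : ℝ) ^ k ≤ (p : ℝ) ^ k := by gcongr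
      have h2 : ((3 / 4 : ℝ)) ^ (2 * max i j) ≤ (3 / 4 : ℝ) ^ (i + j) :=
        pow_le_pow_of_le_one (by norm_num) (by norm_num) (by omega)
      have h3 : ((1 / 2 : ℝ)) ^ (max i j) ≤ (3 / 4 : ℝ) ^ (2 * max i j) := by
        rw [pow_mul]
        gcongr
        norm_num
      calc (2 : ℝ) / (p : ℝ) ^ max i j = 2 / (p * (p : ℝ) ^ k) := by rw [hk, pow_add, pow_one]
        _ ≤ 2 / (p * 2 ^ k) := by gcongr
        _ = 4 / p * (1 / 2 : ℝ) ^ max i j := by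
          rw [hk, Nat.succ_eq_add_one, zero_add, pow_add, pow_one, one_div, inv_pow]
          field_simp
          norm_num
        _ ≤ 4 / p * (3 / 4 : ℝ) ^ (i + j) := by
          gcongr
          exact h3.trans h2
  calc _ ≤ ∑ i ∈ range (e + 1), ∑ j ∈ range (e + 1),
        ((if i = 0 then (if j = 0 then (1 : ℝ) else 0) else 0) +
          4 / p * ((3 / 4 : ℝ) ^ i * (3 / 4 : ℝ) ^ j)) :=
        sum_le_sum fun i _ => sum_le_sum fun j _ => hterm i j
    _ = 1 + 4 / p * ((∑ i ∈ range (e + 1), (3 / 4 : ℝ) ^ i) *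
          ∑ j ∈ range (e + 1), (3 / 4 : ℝ) ^ j) := by
        simp only [sum_add_distrib, ← mul_sum, sum_mul_sum]
        congr 1
        rw [sum_eq_single 0] <;> simp
    _ ≤ 1 + 4 / p * (4 * 4) := by gcongr
    _ = 1 + 64 / p := by ring

/-- Bounds `divisorClassSum (M * p ^ e) a` by classes modulo divisors of `M` and powers of `p`. -/
lemma divisorClassSum_le {p e M : ℕ} (hp : p.Prime) (hM : M ≠ 0) (hc : M.Coprime p) (a : ℕ → ℤ)
    (x : ℤ) :
    divisorClassSum (M * p ^ e) a x ≤ ∑ f ∈ range (e + 1), ∑ m ∈ M.divisors,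
      classInd m (a (m * p ^ f)) x * classInd (p ^ f) (a (m * p ^ f)) x := by
  refine (sum_le_sum_mul_pow (p := p) hM _ (range (e + 1)) (fun d hd => ?_)
    (fun d => classInd d (a d) x) (fun d => classInd_nonneg _ _ _)).trans (le_of_eq ?_)
  · obtain ⟨m, f, hm, hf, h⟩ := exists_mul_pow_of_dvd hp (Nat.dvd_of_mem_divisors hd)
    exact ⟨m, f, hm, mem_range.mpr (by omega), h⟩
  · refine sum_congr rfl fun f _ => sum_congr rfl fun m hm => ?_
    exact classInd_mul (((hc.coprime_dvd_left (Nat.dvd_of_mem_divisors hm))).pow_right f) _ _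

/-- Multiplying a controlled density modulo `M` by a factor `g ≤ 2` of fibre mean `1` gives a
controlled density modulo `M * p ^ e`. -/
lemma IsControlledDensity.mul {Q M p e : ℕ} {w g : ℤ → ℝ} {T : ℝ} (hw : IsControlledDensity Q M w T)
    (hp : p.Prime) (hc : M.Coprime p) (hM : M ≠ 0) (hN : M * p ^ e ∣ Q)
    (hg : Function.Periodic g ((M * p ^ e : ℕ) : ℤ)) (hg0 : ∀ x, 0 ≤ g x) (hg2 : ∀ x, g x ≤ 2)
    (hmean : ∀ F : ℤ → ℝ, Function.Periodic F (M : ℤ) →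
      mean Q (fun x => F x * g x) = mean Q F) :
    IsControlledDensity Q (M * p ^ e) (fun x => w x * g x) (T * (1 + 64 / p)) where
  nonneg x := mul_nonneg (hw.nonneg x) (hg0 x)
  periodic x := by
    simp only [hg x, hw.periodic.of_natCast_dvd (Dvd.intro _ rfl) x]
  mean_eq_one := (hmean w hw.periodic).trans hw.mean_eq_one
  moment_le a b := by
    have hMQ : M ∣ Q := (Dvd.intro _ rfl).trans hN
    have hT : 0 ≤ T := (mean_nonneg fun x => mul_nonneg (hw.nonneg x) (mul_nonneg
      (divisorClassSum_nonneg M 0 x) (divisorClassSum_nonneg M 0 x))).trans (hw.moment_le 0 0)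
    have hpp : (0 : ℝ) < p := by exact_mod_cast hp.pos
    set c : ℕ → ℕ → ℝ := fun i j => if max i j = 0 then (1 : ℝ) else 2 / (p : ℝ) ^ max i j with hcdef
    -- One pair of divisors `m * p ^ i`, `n * p ^ j`.
    have hpair : ∀ i ∈ range (e + 1), ∀ j ∈ range (e + 1), ∀ m ∈ M.divisors, ∀ n ∈ M.divisors,
        ∀ r s u v : ℤ, mean Q (fun x => w x * g x * ((classInd m r x * classInd (p ^ i) u x) *
          (classInd n s x * classInd (p ^ j) v x))) ≤
          c i j * mean Q (fun x => w x * (classInd m r x * classInd n s x)) := by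
      intro i hi j hj m hm n hn r s u v
      have hFper : Function.Periodic (fun x => w x * (classInd m r x * classInd n s x)) (M : ℤ) :=
        fun x => by
          simp only [hw.periodic x,
            (classInd_periodic m r).of_natCast_dvd (Nat.dvd_of_mem_divisors hm) x,
            (classInd_periodic n s).of_natCast_dvd (Nat.dvd_of_mem_divisors hn) x]
      have hF0 : ∀ x, 0 ≤ w x * (classInd m r x * classInd n s x) := fun x =>
        mul_nonneg (hw.nonneg x) (mul_nonneg (classInd_nonneg _ _ _) (classInd_nonneg _ _ _))
      have hi' := mem_range.mp hi
      have hj' := mem_range.mp hj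
      by_cases h0 : max i j = 0
      · simp only [hcdef, if_pos h0, one_mul]
        rw [← hmean _ hFper]
        refine mean_mono fun x => ?_
        calc w x * g x * ((classInd m r x * classInd (p ^ i) u x) *
              (classInd n s x * classInd (p ^ j) v x))
            = w x * (classInd m r x * classInd n s x) * g x *
              (classInd (p ^ i) u x * classInd (p ^ j) v x) := by ring
          _ ≤ w x * (classInd m r x * classInd n s x) * g x :=
            mul_le_of_le_one_right (mul_nonneg (hF0 x) (hg0 x))
              (mul_le_one₀ (classInd_le_one _ _ _) (classInd_nonneg _ _ _) (classInd_le_one _ _ _))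
      · simp only [hcdef, if_neg h0]
        obtain ⟨k, t, hkt, hk, hle⟩ : ∃ k t, k = max i j ∧ k ≤ e ∧
            ∀ x, classInd (p ^ i) u x * classInd (p ^ j) v x ≤ classInd (p ^ k) t x := by
          rcases le_total i j with h | h
          · exact ⟨j, v, (max_eq_right h).symm, by omega, fun x =>
              mul_le_of_le_one_left (classInd_nonneg _ _ _) (classInd_le_one _ _ _)⟩
          · exact ⟨i, u, (max_eq_left h).symm, by omega, fun x =>
              mul_le_of_le_one_right (classInd_nonneg _ _ _) (classInd_le_one _ _ _)⟩
        rw [← hkt]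
        calc _ ≤ mean Q (fun x => 2 * ((w x * (classInd m r x * classInd n s x)) *
                classInd (p ^ k) t x)) := by
              refine mean_mono fun x => ?_
              calc w x * g x * ((classInd m r x * classInd (p ^ i) u x) *
                    (classInd n s x * classInd (p ^ j) v x))
                  = g x * ((w x * (classInd m r x * classInd n s x)) *
                    (classInd (p ^ i) u x * classInd (p ^ j) v x)) := by ring
                _ ≤ 2 * ((w x * (classInd m r x * classInd n s x)) * classInd (p ^ k) t x) := by
                  have := hF0 x
                  have := hle x
                  have := hg2 x
                  have := mul_nonneg (classInd_nonneg (p ^ i) u x) (classInd_nonneg (p ^ j) v x)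
                  gcongr
          _ ≤ 2 * (mean Q (fun x => w x * (classInd m r x * classInd n s x)) / (p ^ k : ℕ)) := by
              rw [mean_const_mul]
              gcongr
              exact mean_mul_classInd_le hMQ (((pow_dvd_pow p hk).mul_left M).trans hN)
                (pow_pos hp.pos k) (hc.symm.pow_left k) hF0 hFper t
          _ = _ := by push_cast; ring
    calc mean Q (fun x => w x * g x *
          (divisorClassSum (M * p ^ e) a x * divisorClassSum (M * p ^ e) b x))
        ≤ mean Q (fun x => w x * g x * ((∑ i ∈ range (e + 1), ∑ m ∈ M.divisors,
            classInd m (a (m * p ^ i)) x * classInd (p ^ i) (a (m * p ^ i)) x) *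
            ∑ j ∈ range (e + 1), ∑ n ∈ M.divisors,
            classInd n (b (n * p ^ j)) x * classInd (p ^ j) (b (n * p ^ j)) x)) := by
          refine mean_mono fun x => ?_
          have := hw.nonneg x
          have := hg0 x
          have := divisorClassSum_nonneg (M * p ^ e) b x
          have h3 := divisorClassSum_le (e := e) hp hM hc a x
          have := (divisorClassSum_nonneg (M * p ^ e) a x).trans h3
          gcongr
          exact divisorClassSum_le hp hM hc b x
      _ = ∑ i ∈ range (e + 1), ∑ j ∈ range (e + 1), ∑ m ∈ M.divisors, ∑ n ∈ M.divisors,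
            mean Q (fun x => w x * g x *
            ((classInd m (a (m * p ^ i)) x * classInd (p ^ i) (a (m * p ^ i)) x) *
            (classInd n (b (n * p ^ j)) x * classInd (p ^ j) (b (n * p ^ j)) x))) := by
          simp only [← mean_sum, ← mul_sum, sum_mul_sum]
      _ ≤ ∑ i ∈ range (e + 1), ∑ j ∈ range (e + 1), ∑ m ∈ M.divisors, ∑ n ∈ M.divisors,
            c i j * mean Q (fun x => w x *
              (classInd m (a (m * p ^ i)) x * classInd n (b (n * p ^ j)) x)) :=
          sum_le_sum fun i hi => sum_le_sum fun j hj => sum_le_sum fun m hm =>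
            sum_le_sum fun n hn => hpair i hi j hj m hm n hn _ _ _ _
      _ = ∑ i ∈ range (e + 1), ∑ j ∈ range (e + 1), c i j * mean Q (fun x => w x *
            (divisorClassSum M (fun m => a (m * p ^ i)) x *
              divisorClassSum M (fun n => b (n * p ^ j)) x)) := by
          simp only [divisorClassSum, ← mul_sum, ← mean_sum, sum_mul_sum]
      _ ≤ ∑ i ∈ range (e + 1), ∑ j ∈ range (e + 1), c i j * T := by
          refine sum_le_sum fun i _ => sum_le_sum fun j _ => ?_
          have : 0 ≤ c i j := by simp only [hcdef]; split_ifs <;> positivity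
          gcongr
          exact hw.moment_le _ _
      _ = T * ∑ i ∈ range (e + 1), ∑ j ∈ range (e + 1), c i j := by
          simp only [← sum_mul]
          ring
      _ ≤ T * (1 + 64 / p) := by
          gcongr
          exact sum_pow_max_le hp e

/-- The distortion step: all the classes whose modulus divides `M * p ^ e` but not `M` can be given
total mass at most `T / (p - 1) ^ 2`, without changing the mass of sets that are periodic modulo
`M`.  On a fibre of which the classes cover a proportion `α < 1 / 2`, their mass is removed; on the
other fibres it is reduced as far as multiplication by at most `2` allows. -/
lemma IsControlledDensity.exists_distortion {Q M p e : ℕ} {w : ℤ → ℝ} {T : ℝ}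
    (hw : IsControlledDensity Q M w T) (hp : p.Prime) (hc : M.Coprime p) (hM : M ≠ 0)
    (hN : M * p ^ e ∣ Q) (D : Finset ℕ) (hD : ∀ d ∈ D, d ∣ M * p ^ e ∧ ¬ d ∣ M) (a : ℕ → ℤ) :
    ∃ w' : ℤ → ℝ, IsControlledDensity Q (M * p ^ e) w' (T * (1 + 64 / p)) ∧
      (∀ F : ℤ → ℝ, Function.Periodic F (M : ℤ) →
        mean Q (fun x => w' x * F x) = mean Q (fun x => w x * F x)) ∧
      mean Q (fun x => w' x * (covered D a).indicator 1 x) ≤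
        T / ((p : ℝ) - 1) ^ 2 := by
  classical
  set β : ℤ → ℝ := (covered D a).indicator 1 with hβ
  set N := M * p ^ e with hNdef
  have hq : 0 < p ^ e := pow_pos hp.pos e
  have hβ01 : ∀ x, β x = 0 ∨ β x = 1 := fun x => by
    by_cases h : x ∈ covered D a <;> simp [hβ, h]
  have hβ0 : ∀ x, 0 ≤ β x := fun x => by rcases hβ01 x with h | h <;> simp [h]
  have hβ1 : ∀ x, β x ≤ 1 := fun x => by rcases hβ01 x with h | h <;> simp [h]
  have hβper : Function.Periodic β (N : ℤ) := covered_indicator_periodic fun d hd => (hD d hd).1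
  set α := fibreMean M (p ^ e) β with hα
  have hαper : Function.Periodic α (M : ℤ) := fibreMean_periodic hβper
  have hαN : Function.Periodic α (N : ℤ) := hαper.of_natCast_dvd (Dvd.intro _ rfl)
  have hα0 : ∀ x, 0 ≤ α x := fibreMean_nonneg hβ0
  -- Both the factor `g` and `g * β` are affine in `β` along each fibre.
  set g : ℤ → ℝ := fun x => if α x < 1 / 2 then (1 - β x) / (1 - α x) else 2 - β x / α x with hg
  have hgper : Function.Periodic g (N : ℤ) := fun x => by simp only [hg, hαN x, hβper x]
  have hg0 : ∀ x, 0 ≤ g x := by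
    intro x
    have := hβ1 x
    simp only [hg]
    split_ifs with h
    · exact div_nonneg (by linarith) (by linarith)
    · have : β x / α x ≤ 2 := by rw [div_le_iff₀ (by linarith)]; linarith
      linarith
  have hg2 : ∀ x, g x ≤ 2 := by
    intro x
    have := hβ0 x
    simp only [hg]
    split_ifs with h
    · rw [div_le_iff₀ (by linarith)]; linarith
    · have : 0 ≤ β x / α x := div_nonneg (hβ0 x) (hα0 x)
      linarith
  have hmean : ∀ F : ℤ → ℝ, Function.Periodic F (M : ℤ) →
      mean Q (fun x => F x * g x) = mean Q F := by
    intro F hF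
    set u : ℤ → ℝ := fun x => if α x < 1 / 2 then F x / (1 - α x) else 2 * F x with hu
    set v : ℤ → ℝ := fun x => if α x < 1 / 2 then F x / (1 - α x) else F x / α x with hv
    have hvper : Function.Periodic v (M : ℤ) := fun x => by simp only [hv, hαper x, hF x]
    calc mean Q (fun x => F x * g x) = mean Q (fun x => u x - v x * β x) := by
          congr 1; funext x
          simp only [hu, hv, hg]
          split_ifs <;> ring
      _ = mean Q (fun x => u x - v x * α x) := by
          rw [mean_sub, mean_sub, mean_mul_fibreMean hN hq hvper hβper]
      _ = mean Q F := by
          congr 1; funext x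
          simp only [hu, hv]
          split_ifs with h
          · have : 1 - α x ≠ 0 := by linarith
            field_simp
          · have : α x ≠ 0 := by linarith
            field_simp
            ring
  have hNM : ∀ F : ℤ → ℝ, Function.Periodic F (M : ℤ) →
      mean Q (fun x => w x * g x * F x) = mean Q (fun x => w x * F x) := by
    intro F hF
    have hwF : Function.Periodic (fun x => w x * F x) (M : ℤ) := fun x => by
      simp only [hw.periodic x, hF x]
    rw [← hmean _ hwF]
    congr 1; funext x; ring
  refine ⟨fun x => w x * g x, hw.mul hp hc hM hN hgper hg0 hg2 hmean, hNM, ?_⟩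
  have hsq : mean Q (fun x => w x * g x * β x) ≤ mean Q (fun x => w x * α x ^ 2) := by
    set v : ℤ → ℝ := fun x => if α x < 1 / 2 then 0 else w x * (2 - 1 / α x) with hv
    have hvper : Function.Periodic v (M : ℤ) := fun x => by simp only [hv, hαper x, hw.periodic x]
    calc mean Q (fun x => w x * g x * β x) = mean Q (fun x => v x * β x) := by
          congr 1; funext x
          rcases hβ01 x with h | h
          · simp [h]
          · simp only [hv, hg, h]
            split_ifs <;> ring
      _ = mean Q (fun x => v x * α x) := mean_mul_fibreMean hN hq hvper hβper
      _ ≤ mean Q (fun x => w x * α x ^ 2) := by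
          refine mean_mono fun x => ?_
          have h0 := hw.nonneg x
          simp only [hv]
          split_ifs with h
          · rw [zero_mul]; positivity
          · have : α x ≠ 0 := by linarith
            have h1 : w x * (2 - 1 / α x) * α x = w x * (2 * α x - 1) := by field_simp
            rw [h1]
            gcongr
            nlinarith [sq_nonneg (α x - 1)]
  refine hsq.trans ?_
  have hpr : (1 : ℝ) < p := by exact_mod_cast hp.one_lt
  set t := Icc 1 e
  set u : ℕ → ℤ → ℝ := fun f => divisorClassSum M (fun m => a (m * p ^ f)) with hu
  have hαle : ∀ x, α x ≤ ∑ f ∈ t, (1 / (p : ℝ) ^ f) * u f x := by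
    intro x
    have hβle : ∀ y, β y ≤ ∑ f ∈ t, ∑ m ∈ M.divisors,
        classInd m (a (m * p ^ f)) y * classInd (p ^ f) (a (m * p ^ f)) y := by
      intro y
      have h1 : β y ≤ ∑ d ∈ D, classInd d (a d) y := by
        by_cases h : y ∈ covered D a
        · obtain ⟨d, hd, hdy⟩ := h
          refine (hβ1 y).trans ?_
          have h2 : classInd d (a d) y = 1 := if_pos hdy
          rw [← h2]
          exact single_le_sum (f := fun d => classInd d (a d) y)
            (fun d _ => classInd_nonneg _ _ _) hd
        · have : β y = 0 := by simp only [hβ, Set.indicator_of_notMem h]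
          rw [this]
          exact sum_nonneg fun d _ => classInd_nonneg _ _ _
      refine h1.trans ((sum_le_sum_mul_pow (p := p) hM D t (fun d hd => ?_)
        (fun d => classInd d (a d) y) (fun d => classInd_nonneg _ _ _)).trans (le_of_eq ?_))
      · obtain ⟨m, f, hm, hf, h⟩ := exists_mul_pow_of_dvd hp (hD d hd).1
        refine ⟨m, f, hm, mem_Icc.mpr ⟨?_, hf⟩, h⟩
        by_contra hf0
        have : f = 0 := by omega
        subst this
        exact (hD d hd).2 (by simpa [h] using hm)
      · refine sum_congr rfl fun f _ => sum_congr rfl fun m hm => ?_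
        exact classInd_mul (((hc.coprime_dvd_left (Nat.dvd_of_mem_divisors hm))).pow_right f) _ _
    calc α x ≤ fibreMean M (p ^ e) (fun y => ∑ f ∈ t, ∑ m ∈ M.divisors,
          classInd m (a (m * p ^ f)) y * classInd (p ^ f) (a (m * p ^ f)) y) x :=
          fibreMean_mono hβle x
      _ = ∑ f ∈ t, ∑ m ∈ M.divisors, fibreMean M (p ^ e) (fun y =>
          classInd m (a (m * p ^ f)) y * classInd (p ^ f) (a (m * p ^ f)) y) x := by
          simp only [fibreMean, mean_sum]
      _ ≤ ∑ f ∈ t, ∑ m ∈ M.divisors,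
          (1 / (p : ℝ) ^ f) * classInd m (a (m * p ^ f)) x := by
          refine sum_le_sum fun f hf => sum_le_sum fun m hm => ?_
          rw [fibreMean_mul _ ((classInd_periodic m _).of_natCast_dvd
            (Nat.dvd_of_mem_divisors hm)), mul_comm]
          have := classInd_nonneg m (a (m * p ^ f)) x
          gcongr
          have h1 := fibreMean_classInd_le hq (pow_dvd_pow p (mem_Icc.mp hf).2)
            (hc.symm.pow_left f) (a (m * p ^ f)) x
          push_cast at h1
          exact h1
      _ = ∑ f ∈ t, (1 / (p : ℝ) ^ f) * u f x := by
          simp only [hu, divisorClassSum, mul_sum]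
  have hgeo : ∑ f ∈ t, 1 / (p : ℝ) ^ f ≤ 1 / (p - 1) := by
    have h1 : ∑ f ∈ t, 1 / (p : ℝ) ^ f = ∑ f ∈ Ico 1 (e + 1), (1 / (p : ℝ)) ^ f := by
      refine sum_congr ?_ fun f _ => by rw [one_div_pow]
      ext f; simp [t]
    rw [h1, geom_sum_Ico' (by rw [Ne, div_eq_one_iff_eq (by positivity)]; linarith) (by omega)]
    rw [div_le_div_iff₀ (by rw [sub_pos, div_lt_one (by positivity)]; exact hpr) (by linarith)]
    have : 0 ≤ (1 / (p : ℝ)) ^ (e + 1) * (p - 1) := mul_nonneg (by positivity) (by linarith)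
    have h2 : (1 / (p : ℝ)) * p = 1 := by field_simp
    nlinarith
  have hT : 0 ≤ T := (mean_nonneg fun x => mul_nonneg (hw.nonneg x) (mul_nonneg
    (divisorClassSum_nonneg M 0 x) (divisorClassSum_nonneg M 0 x))).trans (hw.moment_le 0 0)
  have hgeo0 : 0 ≤ ∑ f ∈ t, 1 / (p : ℝ) ^ f := sum_nonneg fun _ _ => by positivity
  calc mean Q (fun x => w x * α x ^ 2)
      ≤ mean Q (fun x => w x * (∑ f ∈ t, (1 / (p : ℝ) ^ f) * u f x) ^ 2) := by
        refine mean_mono fun x => ?_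
        have := hw.nonneg x
        have := hα0 x
        gcongr
        exact hαle x
    _ = ∑ i ∈ t, ∑ j ∈ t, 1 / (p : ℝ) ^ i * (1 / (p : ℝ) ^ j) *
          mean Q (fun x => w x * (u i x * u j x)) := by
        simp only [← mean_const_mul, ← mean_sum]
        congr 1; funext x
        rw [sq, sum_mul_sum, mul_sum]
        refine sum_congr rfl fun i _ => ?_
        rw [mul_sum]
        refine sum_congr rfl fun j _ => ?_
        ring
    _ ≤ ∑ i ∈ t, ∑ j ∈ t, 1 / (p : ℝ) ^ i * (1 / (p : ℝ) ^ j) * T := by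
        refine sum_le_sum fun i _ => sum_le_sum fun j _ => ?_
        gcongr
        exact hw.moment_le _ _
    _ = (∑ f ∈ t, 1 / (p : ℝ) ^ f) ^ 2 * T := by
        simp only [← sum_mul, sq, sum_mul_sum]
    _ ≤ (1 / (p - 1)) ^ 2 * T := by gcongr
    _ = T / ((p : ℝ) - 1) ^ 2 := by rw [one_div, inv_pow]; ring

/-! ### Iterating over the primes -/

/-- The largest divisor of `Q` all of whose prime factors are less than `n`. -/
def smoothPart (Q n : ℕ) : ℕ :=
  ∏ p ∈ n.primesBelow, p ^ Q.factorization p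

/-- The bound on the second moment after the primes less than `n` have been treated. -/
noncomputable def momentBound (n : ℕ) : ℝ :=
  ∏ p ∈ n.primesBelow, (1 + 64 / (p : ℝ))

lemma smoothPart_succ_of_prime {Q p : ℕ} (hp : p.Prime) :
    smoothPart Q (p + 1) = smoothPart Q p * p ^ Q.factorization p := by
  rw [smoothPart, Nat.primesBelow_succ, if_pos hp, prod_insert (by simp [Nat.primesBelow]),
    mul_comm, smoothPart]

lemma smoothPart_succ_of_not_prime {Q n : ℕ} (hn : ¬ n.Prime) :
    smoothPart Q (n + 1) = smoothPart Q n := by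
  rw [smoothPart, Nat.primesBelow_succ, if_neg hn, smoothPart]

lemma momentBound_succ_of_prime {p : ℕ} (hp : p.Prime) :
    momentBound (p + 1) = momentBound p * (1 + 64 / p) := by
  rw [momentBound, Nat.primesBelow_succ, if_pos hp, prod_insert (by simp [Nat.primesBelow]),
    mul_comm, momentBound]

lemma momentBound_succ_of_not_prime {n : ℕ} (hn : ¬ n.Prime) :
    momentBound (n + 1) = momentBound n := by
  rw [momentBound, Nat.primesBelow_succ, if_neg hn, momentBound]

lemma smoothPart_ne_zero (Q n : ℕ) : smoothPart Q n ≠ 0 :=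
  prod_ne_zero_iff.mpr fun _ hp => pow_ne_zero _ (Nat.prime_of_mem_primesBelow hp).ne_zero

lemma coprime_smoothPart {Q p : ℕ} (hp : p.Prime) : (smoothPart Q p).Coprime p := by
  refine Nat.Coprime.prod_left fun q hq => Nat.Coprime.pow_left _ ?_
  exact (Nat.coprime_primes (Nat.prime_of_mem_primesBelow hq) hp).mpr
    (Nat.lt_of_mem_primesBelow hq).ne

lemma smoothPart_dvd (Q n : ℕ) : smoothPart Q n ∣ Q := by
  induction n with
  | zero => simp [smoothPart, Nat.primesBelow]
  | succ n ih =>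
    by_cases hn : n.Prime
    · rw [smoothPart_succ_of_prime hn]
      exact ((coprime_smoothPart hn).pow_right _).mul_dvd_of_dvd_of_dvd ih (Nat.ordProj_dvd Q n)
    · rwa [smoothPart_succ_of_not_prime hn]

lemma dvd_smoothPart_of_lt {Q n : ℕ} (hQ : Q ≠ 0) (h : Q < n) : Q ∣ smoothPart Q n := by
  conv_lhs => rw [← Nat.prod_factorization_pow_eq_self hQ]
  refine prod_dvd_prod_of_subset _ _ _ fun p hp => ?_
  rw [Nat.support_factorization] at hp
  exact Nat.mem_primesBelow.mpr
    ⟨(Nat.le_of_mem_primeFactors hp).trans_lt h, Nat.prime_of_mem_primeFactors hp⟩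

lemma isControlledDensity_one {Q : ℕ} (hQ : 0 < Q) (n : ℕ) :
    IsControlledDensity Q (smoothPart Q n) (fun _ => 1) (momentBound n) := by
  induction n with
  | zero =>
    refine ⟨fun _ => zero_le_one, fun _ => rfl, mean_const hQ 1, fun a b => le_of_eq ?_⟩
    have h1 : ∀ a : ℕ → ℤ, divisorClassSum (smoothPart Q 0) a = fun _ => 1 := fun a => by
      funext x
      rw [smoothPart, Nat.primesBelow_zero, prod_empty, divisorClassSum, Nat.divisors_one,
        sum_singleton, classInd, if_pos (by simp)]
    simp only [h1, mul_one, momentBound, Nat.primesBelow_zero, prod_empty, mean_const hQ]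
  | succ n ih =>
    by_cases hn : n.Prime
    · rw [smoothPart_succ_of_prime hn, momentBound_succ_of_prime hn]
      have := ih.mul (g := fun _ => 1) hn (coprime_smoothPart hn) (smoothPart_ne_zero Q n)
        (e := Q.factorization n) (by rw [← smoothPart_succ_of_prime hn]; exact smoothPart_dvd _ _)
        (fun _ => rfl) (fun _ => zero_le_one) (fun _ => one_le_two) (fun F _ => by simp)
      simpa using this
    · rwa [smoothPart_succ_of_not_prime hn, momentBound_succ_of_not_prime hn]

/-- Distorting the uniform density at all primes from `y` on makes the classes whose moduli have
such a prime factor small, and does not affect sets periodic modulo the `y`-smooth part of `Q`. -/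
lemma exists_density {Q : ℕ} (hQ : 0 < Q) (D : Finset ℕ) (a : ℕ → ℤ) (y n : ℕ) (hyn : y ≤ n) :
    ∃ w : ℤ → ℝ, IsControlledDensity Q (smoothPart Q n) w (momentBound n) ∧
      (∀ F : ℤ → ℝ, Function.Periodic F (smoothPart Q y : ℤ) →
        mean Q (fun x => w x * F x) = mean Q F) ∧
      mean Q (fun x => w x * (covered (D.filter fun d => d ∣ smoothPart Q n ∧
        ¬ d ∣ smoothPart Q y) a).indicator 1 x) ≤
        ∑ p ∈ (Ico y n).filter Nat.Prime, momentBound p / ((p : ℝ) - 1) ^ 2 := by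
  classical
  induction n, hyn using Nat.le_induction with
  | base =>
    refine ⟨fun _ => 1, isControlledDensity_one hQ y, fun F _ => by simp, ?_⟩
    simp [covered, mean_const hQ]
  | succ n hyn ih =>
    obtain ⟨w, hw, hwF, hwB⟩ := ih
    have hIco : Ico y (n + 1) = insert n (Ico y n) := (insert_Ico_right_eq_Ico_add_one hyn).symm
    by_cases hn : n.Prime
    · have hdvd := smoothPart_dvd Q (n + 1)
      have hyd : smoothPart Q y ∣ smoothPart Q n :=
        prod_dvd_prod_of_subset _ _ _ (Nat.primesBelow_mono hyn)
      obtain ⟨w', hw', hF, hB⟩ := hw.exists_distortion hn (coprime_smoothPart hn)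
        (smoothPart_ne_zero Q n) (e := Q.factorization n)
        (by rw [← smoothPart_succ_of_prime hn]; exact hdvd)
        (D.filter fun d => d ∣ smoothPart Q (n + 1) ∧ ¬ d ∣ smoothPart Q n)
        (fun d hd => by
          rw [← smoothPart_succ_of_prime hn]; exact (mem_filter.mp hd).2) a
      rw [← smoothPart_succ_of_prime hn, ← momentBound_succ_of_prime hn] at hw'
      refine ⟨w', hw', fun F hFp => (hF F (hFp.of_natCast_dvd hyd)).trans (hwF F hFp), ?_⟩
      rw [hIco, filter_insert, if_pos hn, sum_insert (by simp)]
      set U := D.filter fun d => d ∣ smoothPart Q n ∧ ¬ d ∣ smoothPart Q y with hU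
      set V := D.filter fun d => d ∣ smoothPart Q (n + 1) ∧ ¬ d ∣ smoothPart Q n with hV
      have hUper : Function.Periodic ((covered U a).indicator (1 : ℤ → ℝ))
          (smoothPart Q n : ℤ) := by
        refine covered_indicator_periodic fun d hd => ?_
        exact (mem_filter.mp hd).2.1
      refine le_trans ?_ (add_le_add hB (le_of_eq_of_le (hF _ hUper) hwB))
      rw [← mean_add]
      refine mean_mono fun x => ?_
      rw [← mul_add]
      refine mul_le_mul_of_nonneg_left ?_ (hw'.nonneg x)
      have h0 : ∀ E : Finset ℕ, 0 ≤ (covered E a).indicator (1 : ℤ → ℝ) x := fun E =>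
        Set.indicator_nonneg (fun _ _ => zero_le_one) x
      by_cases hx : x ∈ covered (D.filter fun d => d ∣ smoothPart Q (n + 1) ∧
        ¬ d ∣ smoothPart Q y) a
      · rw [Set.indicator_of_mem hx, Pi.one_apply]
        obtain ⟨d, hd, hdx⟩ := hx
        obtain ⟨hdD, hd1, hd2⟩ := mem_filter.mp hd
        by_cases hdn : d ∣ smoothPart Q n
        · have : x ∈ covered U a := ⟨d, mem_filter.mpr ⟨hdD, hdn, hd2⟩, hdx⟩
          rw [Set.indicator_of_mem this, Pi.one_apply]
          linarith [h0 V]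
        · have : x ∈ covered V a := ⟨d, mem_filter.mpr ⟨hdD, hd1, hdn⟩, hdx⟩
          rw [Set.indicator_of_mem this, Pi.one_apply]
          linarith [h0 U]
      · rw [Set.indicator_of_notMem hx]
        exact add_nonneg (h0 V) (h0 U)
    · rw [hIco, filter_insert, if_neg hn, smoothPart_succ_of_not_prime hn,
        momentBound_succ_of_not_prime hn]
      exact ⟨w, hw, hwF, hwB⟩

/-! ### The density of the uncovered set -/

/-- An exponential sum with `#s` frequencies that vanishes at `#s` consecutive integers vanishes at
all later integers, since it satisfies a linear recurrence of order `#s`. -/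
lemma expSum_eq_zero_of_forall_lt {ι : Type*} (s : Finset ι) (c z : ι → ℂ)
    (hz : ∀ i ∈ s, z i ≠ 0) (x : ℤ) (h : ∀ t < s.card, ∑ i ∈ s, c i * z i ^ (x + (t : ℤ)) = 0)
    (m : ℕ) : ∑ i ∈ s, c i * z i ^ (x + (m : ℤ)) = 0 := by
  set f : ℤ → ℂ := fun n => ∑ i ∈ s, c i * z i ^ n with hf
  set P : Polynomial ℂ := ∏ i ∈ s, (Polynomial.X - Polynomial.C (z i)) with hP
  have hmonic : P.Monic := Polynomial.monic_prod_of_monic _ _ fun i _ => Polynomial.monic_X_sub_C _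
  have hdeg : P.natDegree = s.card := by
    rw [hP, Polynomial.natDegree_prod_of_monic _ _ fun i _ => Polynomial.monic_X_sub_C _]
    simp
  have hrec : ∀ n : ℤ, ∑ k ∈ range (s.card + 1), P.coeff k * f (n + k) = 0 := by
    intro n
    simp only [hf, mul_sum]
    rw [sum_comm]
    refine sum_eq_zero fun i hi => ?_
    have h0 : P.eval (z i) = 0 := by
      rw [hP, Polynomial.eval_prod]
      exact prod_eq_zero hi (by simp)
    rw [Polynomial.eval_eq_sum_range, hdeg] at h0
    calc ∑ k ∈ range (s.card + 1), P.coeff k * (c i * z i ^ (n + (k : ℤ)))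
        = c i * z i ^ n * ∑ k ∈ range (s.card + 1), P.coeff k * z i ^ k := by
          rw [mul_sum]
          refine sum_congr rfl fun k _ => ?_
          rw [zpow_add₀ (hz i hi), zpow_natCast]
          ring
      _ = 0 := by rw [h0, mul_zero]
  change f (x + m) = 0
  induction m using Nat.strong_induction_on with
  | _ m ih =>
    rcases lt_or_ge m s.card with hm | hm
    · exact h m hm
    · obtain ⟨r, rfl⟩ := Nat.exists_eq_add_of_le hm
      have h1 := hrec (x + r)
      have hlead : P.coeff s.card = 1 := by rw [← hdeg]; exact hmonic.coeff_natDegree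
      rw [sum_range_succ, hlead, one_mul, sum_eq_zero, zero_add] at h1
      · rw [← h1]
        congr 1
        push_cast
        ring
      · intro k hk
        have := ih (r + k) (by have := mem_range.mp hk; omega)
        push_cast at this
        rw [← add_assoc] at this
        rw [this, mul_zero]

/-- If residue classes with moduli in `D` do not cover `ℤ`, then any `2 ^ #D` consecutive integers
include an uncovered one. -/
lemma exists_notMem_covered (D : Finset ℕ) (hD : ∀ d ∈ D, 0 < d) (a : ℕ → ℤ) (x₀ : ℤ)
    (hx₀ : x₀ ∉ covered D a) (x : ℤ) : ∃ t < 2 ^ D.card, x + ((t : ℕ) : ℤ) ∉ covered D a := by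
  classical
  by_contra! hcon
  set ζ : ℕ → ℂ := fun d => Complex.exp (2 * Real.pi * Complex.I / d) with hζ
  have hprim : ∀ d ∈ D, IsPrimitiveRoot (ζ d) d := fun d hd =>
    Complex.isPrimitiveRoot_exp d (hD d hd).ne'
  have hζ0 : ∀ d, ζ d ≠ 0 := fun d => Complex.exp_ne_zero _
  -- The product of `1 - ζ_d ^ (n - a_d)` vanishes exactly on the covered set.
  have hprod : ∀ n : ℤ, ∏ d ∈ D, (1 - ζ d ^ (n - a d)) = 0 ↔ n ∈ covered D a := by
    intro n
    rw [prod_eq_zero_iff]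
    refine exists_congr fun d => and_congr_right fun hd => ?_
    rw [sub_eq_zero, eq_comm, (hprim d hd).zpow_eq_one_iff_dvd]
  have hexp : ∀ n : ℤ, ∏ d ∈ D, (1 - ζ d ^ (n - a d)) =
      ∑ S ∈ D.powerset, (∏ d ∈ S, -ζ d ^ (-a d)) * (∏ d ∈ S, ζ d) ^ n := by
    intro n
    have h1 : ∀ d ∈ D, (1 - ζ d ^ (n - a d)) = -ζ d ^ (-a d) * ζ d ^ n + 1 := by
      intro d _
      rw [sub_eq_add_neg n, zpow_add₀ (hζ0 d)]
      ring
    rw [prod_congr rfl h1, prod_add]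
    refine sum_congr rfl fun S _ => ?_
    rw [prod_const_one, mul_one, prod_mul_distrib, prod_zpow]
  have hall : ∀ m : ℕ, x + (m : ℤ) ∈ covered D a := by
    intro m
    rw [← hprod, hexp]
    refine expSum_eq_zero_of_forall_lt D.powerset _ _
      (fun S _ => prod_ne_zero_iff.mpr fun d _ => hζ0 d) x (fun t ht => ?_) m
    rw [card_powerset] at ht
    rw [← hexp, hprod]
    exact hcon t ht
  -- A translate of `x₀` by a multiple of all moduli lies to the right of `x`.
  set L : ℕ := ∏ d ∈ D, d with hL
  have hLpos : 0 < L := prod_pos hD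
  have hge : x ≤ x₀ + L * |x - x₀| := by
    have h1 : (1 : ℤ) ≤ L := by exact_mod_cast hLpos
    nlinarith [le_abs_self (x - x₀), abs_nonneg (x - x₀)]
  obtain ⟨m, hm⟩ := Int.eq_ofNat_of_zero_le (sub_nonneg.mpr hge)
  obtain ⟨d, hd, hdx⟩ := hall m
  refine hx₀ ⟨d, hd, ?_⟩
  have hdL : (d : ℤ) ∣ L * |x - x₀| :=
    (Int.natCast_dvd_natCast.mpr (dvd_prod_of_mem (fun d => d) hd)).mul_right _
  have h2 : x + (m : ℤ) - a d = (x₀ - a d) + L * |x - x₀| := by linarith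
  rw [h2] at hdx
  exact (dvd_add_left hdL).mp hdx

lemma le_mean_uncovered {Q : ℕ} (hQ : 0 < Q) (D : Finset ℕ) (hD : ∀ d ∈ D, d ∣ Q) (a : ℕ → ℤ)
    (x₀ : ℤ) (hx₀ : x₀ ∉ covered D a) :
    (1 / 2 : ℝ) ^ D.card ≤ mean Q ((covered D a)ᶜ.indicator 1) := by
  set f : ℤ → ℝ := (covered D a)ᶜ.indicator 1 with hf
  have hf0 : ∀ x, 0 ≤ f x := fun x => Set.indicator_nonneg (fun _ _ => zero_le_one) x
  have hper : Function.Periodic f (Q : ℤ) := by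
    have h1 : f = fun x => 1 - (covered D a).indicator 1 x := by
      rw [hf, Set.indicator_compl]; rfl
    have h2 := covered_indicator_periodic (a := a) hD
    rw [h1]
    intro x
    simp only [h2 x]
  have hsum : ∀ x : ℤ, 1 ≤ ∑ t ∈ range (2 ^ D.card), f (x + t) := by
    intro x
    obtain ⟨t, ht, hx⟩ := exists_notMem_covered D
      (fun d hd => Nat.pos_of_dvd_of_pos (hD d hd) hQ) a x₀ hx₀ x
    have h1 : f (x + t) = 1 := Set.indicator_of_mem hx _
    rw [← h1]
    exact single_le_sum (f := fun t : ℕ => f (x + t)) (fun t _ => hf0 _) (mem_range.mpr ht)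
  have h1 : (1 : ℝ) ≤ 2 ^ D.card * mean Q f := by
    calc (1 : ℝ) = mean Q (fun _ => 1) := (mean_const hQ 1).symm
      _ ≤ mean Q (fun x => ∑ t ∈ range (2 ^ D.card), f (x + t)) := mean_mono hsum
      _ = 2 ^ D.card * mean Q f := by
        rw [mean_sum, sum_congr rfl fun t _ => mean_shift hper t]
        simp
  rw [one_div, inv_pow]
  exact (inv_le_iff_one_le_mul₀' (by positivity)).mpr h1

/-- Balance of masses for a covering: the set left uncovered by the classes with modulus less than
`q` has to be absorbed by the classes with a `y`-smooth modulus at least `q`, of density `1 / d`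
each, and by those whose modulus has a prime factor at least `y`, whose mass has been distorted. -/
lemma le_sum_of_covered {Q : ℕ} (hQ : 0 < Q) (D : Finset ℕ) (hD : ∀ d ∈ D, d ∣ Q) (a : ℕ → ℤ)
    (hcov : ∀ x, x ∈ covered D a) (y q : ℕ) (x₀ : ℤ)
    (hx₀ : x₀ ∉ covered (D.filter (· < q)) a) :
    (1 / 2 : ℝ) ^ (D.filter (· < q)).card ≤
      ∑ d ∈ D.filter (fun d => q ≤ d ∧ d ∈ Nat.smoothNumbers y), 1 / (d : ℝ) +
      ∑ p ∈ (Ico y (Q + 1 + y)).filter Nat.Prime, momentBound p / ((p : ℝ) - 1) ^ 2 := by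
  classical
  obtain ⟨w, hw, hwF, hwB⟩ := exists_density hQ D a y (Q + 1 + y) (by omega)
  set S := (D.filter (· < q)).filter fun d => d ∣ smoothPart Q y with hS
  set E := D.filter (fun d => q ≤ d ∧ d ∈ Nat.smoothNumbers y) with hE
  set B := D.filter fun d => d ∣ smoothPart Q (Q + 1 + y) ∧ ¬ d ∣ smoothPart Q y with hB
  have hsub : ∀ d ∈ D.filter fun d => q ≤ d ∧ d ∣ smoothPart Q y, d ∈ E := by
    intro d hd
    obtain ⟨hdD, hq, hdy⟩ := mem_filter.mp hd
    refine mem_filter.mpr ⟨hdD, hq, Nat.mem_smoothNumbers'.mpr fun p hp hpd => ?_⟩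
    obtain ⟨r, hr, hpr⟩ := (hp.prime.dvd_finsetProd_iff _).mp (hpd.trans hdy)
    have := (Nat.prime_dvd_prime_iff_eq hp (Nat.prime_of_mem_primesBelow hr)).mp
      (hp.dvd_of_dvd_pow hpr)
    exact this ▸ Nat.lt_of_mem_primesBelow hr
  have hx₀S : x₀ ∉ covered S a := fun ⟨d, hd, h⟩ => hx₀ ⟨d, (mem_filter.mp hd).1, h⟩
  have hSy : ∀ d ∈ S, d ∣ smoothPart Q y := fun d hd => (mem_filter.mp hd).2
  have hcompl : Function.Periodic ((covered S a)ᶜ.indicator (1 : ℤ → ℝ)) (smoothPart Q y : ℤ) := by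
    have h2 := covered_indicator_periodic (a := a) hSy
    rw [Set.indicator_compl]
    intro x
    simp only [Pi.sub_apply, h2 x, Pi.one_apply]
  set E' := D.filter fun d => q ≤ d ∧ d ∣ smoothPart Q y with hE'
  calc (1 / 2 : ℝ) ^ (D.filter (· < q)).card ≤ (1 / 2 : ℝ) ^ S.card :=
        pow_le_pow_of_le_one (by norm_num) (by norm_num) (card_filter_le _ _)
    _ ≤ mean Q ((covered S a)ᶜ.indicator 1) :=
        le_mean_uncovered hQ S (fun d hd => (hSy d hd).trans (smoothPart_dvd Q y)) a x₀ hx₀S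
    _ = mean Q (fun x => w x * (covered S a)ᶜ.indicator 1 x) := (hwF _ hcompl).symm
    _ ≤ mean Q (fun x => ∑ d ∈ E', w x * classInd d (a d) x +
          w x * (covered B a).indicator 1 x) := by
        refine mean_mono fun x => ?_
        rw [← mul_sum, ← mul_add]
        refine mul_le_mul_of_nonneg_left ?_ (hw.nonneg x)
        have hB0 : 0 ≤ (covered B a).indicator (1 : ℤ → ℝ) x :=
          Set.indicator_nonneg (fun _ _ => zero_le_one) x
        have hE0 : 0 ≤ ∑ d ∈ E', classInd d (a d) x := sum_nonneg fun _ _ => classInd_nonneg _ _ _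
        by_cases hx : x ∈ covered S a
        · rw [Set.indicator_of_notMem (by simpa using hx)]
          exact add_nonneg hE0 hB0
        · rw [Set.indicator_of_mem (by simpa using hx), Pi.one_apply]
          obtain ⟨d, hd, hdx⟩ := hcov x
          by_cases hdy : d ∣ smoothPart Q y
          · have hqd : q ≤ d := by
              by_contra hlt
              exact hx ⟨d, mem_filter.mpr ⟨mem_filter.mpr ⟨hd, by omega⟩, hdy⟩, hdx⟩
            have h1 : classInd d (a d) x = 1 := if_pos hdx
            have h2 := single_le_sum (f := fun d => classInd d (a d) x)
              (fun d _ => classInd_nonneg _ _ _) (mem_filter.mpr ⟨hd, hqd, hdy⟩ : d ∈ E')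
            simp only [h1] at h2
            linarith
          · have : x ∈ covered B a := ⟨d, mem_filter.mpr ⟨hd, (hD d hd).trans
              (dvd_smoothPart_of_lt hQ.ne' (by omega)), hdy⟩, hdx⟩
            rw [Set.indicator_of_mem this, Pi.one_apply]
            linarith
    _ = ∑ d ∈ E', mean Q (classInd d (a d)) +
          mean Q (fun x => w x * (covered B a).indicator 1 x) := by
        rw [mean_add, mean_sum]
        congr 1
        refine sum_congr rfl fun d hd => hwF _ ?_
        exact (classInd_periodic d _).of_natCast_dvd (mem_filter.mp hd).2.2
    _ ≤ ∑ d ∈ E, 1 / (d : ℝ) +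
          ∑ p ∈ (Ico y (Q + 1 + y)).filter Nat.Prime, momentBound p / ((p : ℝ) - 1) ^ 2 := by
        refine add_le_add ?_ hwB
        calc ∑ d ∈ E', mean Q (classInd d (a d)) ≤ ∑ d ∈ E', 1 / (d : ℝ) :=
              sum_le_sum fun d hd => mean_classInd_le hQ (hD d (mem_filter.mp hd).1) _
          _ ≤ ∑ d ∈ E, 1 / (d : ℝ) :=
              sum_le_sum_of_subset_of_nonneg hsub fun _ _ _ => by positivity

/-! ### Estimates for primes and smooth numbers -/

/-- Chebyshev's bound on a dyadic interval, from `∏_{p ≤ n} p ≤ 4 ^ n`. -/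
lemma sum_inv_primes_dyadic_le {m : ℕ} (hm : 0 < m) :
    ∑ p ∈ (Ico (2 ^ m) (2 ^ (m + 1))).filter Nat.Prime, 1 / (p : ℝ) ≤ 4 / m := by
  set s := (Ico (2 ^ m) (2 ^ (m + 1))).filter Nat.Prime with hs
  have h1 : (2 ^ m) ^ s.card ≤ ∏ p ∈ s, p :=
    pow_card_le_prod s _ _ fun p hp => (mem_Ico.mp (mem_filter.mp hp).1).1
  have h2 : ∏ p ∈ s, p ≤ primorial (2 ^ (m + 1)) := by
    refine Nat.le_of_dvd (primorial_pos _) (prod_dvd_prod_of_subset _ _ _ fun p hp => ?_)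
    obtain ⟨hp1, hp2⟩ := mem_filter.mp hp
    simp [hp2, (mem_Ico.mp hp1).2.le]
  have h3 : (2 ^ m) ^ s.card ≤ 2 ^ (2 ^ (m + 2)) := by
    calc (2 ^ m) ^ s.card ≤ 4 ^ (2 ^ (m + 1)) := (h1.trans h2).trans (primorial_le_four_pow _)
      _ = 2 ^ (2 ^ (m + 2)) := by
        rw [show (4 : ℕ) = 2 ^ 2 by norm_num, ← pow_mul]
        congr 1
        ring
  have h4 : m * s.card ≤ 2 ^ (m + 2) := by
    rw [← pow_mul] at h3
    exact (Nat.pow_le_pow_iff_right (by norm_num)).mp h3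
  have h5 : (m : ℝ) * s.card ≤ 4 * 2 ^ m := by
    have : ((m * s.card : ℕ) : ℝ) ≤ ((2 ^ (m + 2) : ℕ) : ℝ) := by exact_mod_cast h4
    push_cast at this
    linarith [pow_add (2 : ℝ) m 2]
  calc ∑ p ∈ s, 1 / (p : ℝ) ≤ ∑ _p ∈ s, 1 / (2 : ℝ) ^ m := by
        refine sum_le_sum fun p hp => ?_
        have : ((2 ^ m : ℕ) : ℝ) ≤ p := by
          exact_mod_cast (mem_Ico.mp (mem_filter.mp hp).1).1
        push_cast at this
        gcongr
    _ = s.card / (2 : ℝ) ^ m := by simp [div_eq_mul_inv]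
    _ ≤ 4 / m := by
        rw [div_le_div_iff₀ (by positivity) (by positivity)]
        linarith

/-- A weak form of Mertens' bound `∑_{p < x} 1 / p = O(log log x)`, which suffices here. -/
lemma sum_inv_primesBelow_two_pow_le (m : ℕ) :
    ∑ p ∈ Nat.primesBelow (2 ^ m), 1 / (p : ℝ) ≤ 16 * √m := by
  induction m with
  | zero =>
    have : Nat.primesBelow (2 ^ 0) = ∅ := by decide
    rw [this]
    simp
  | succ m ih =>
    rcases Nat.eq_zero_or_pos m with rfl | hm
    · have : Nat.primesBelow (2 ^ (0 + 1)) = ∅ := by decide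
      rw [this]
      simp
    · have hsplit : Nat.primesBelow (2 ^ (m + 1)) =
          Nat.primesBelow (2 ^ m) ∪ (Ico (2 ^ m) (2 ^ (m + 1))).filter Nat.Prime := by
        ext p
        have : 2 ^ m < 2 ^ (m + 1) := Nat.pow_lt_pow_right (by norm_num) (by omega)
        simp only [Nat.mem_primesBelow, mem_union, mem_filter, mem_Ico]
        by_cases hp : p.Prime <;> simp [hp]
        omega
      have hdisj : Disjoint (Nat.primesBelow (2 ^ m))
          ((Ico (2 ^ m) (2 ^ (m + 1))).filter Nat.Prime) := by
        rw [disjoint_left]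
        intro p h1 h2
        have := Nat.lt_of_mem_primesBelow h1
        have := (mem_Ico.mp (mem_filter.mp h2).1).1
        omega
      rw [hsplit, sum_union hdisj]
      have h1 := sum_inv_primes_dyadic_le hm
      have hm1 : (1 : ℝ) ≤ m := by exact_mod_cast hm
      have hs : √(m : ℝ) ≤ m := by
        rw [Real.sqrt_le_left (by linarith)]; nlinarith
      have ht : √((m : ℝ) + 1) ≤ 2 * m := by
        rw [Real.sqrt_le_left (by linarith)]; nlinarith
      have hs2 := Real.sq_sqrt (show (0 : ℝ) ≤ m by linarith)
      have ht2 := Real.sq_sqrt (show (0 : ℝ) ≤ (m : ℝ) + 1 by linarith)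
      have hst : √(m : ℝ) ≤ √((m : ℝ) + 1) := Real.sqrt_le_sqrt (by linarith)
      have hs0 := Real.sqrt_nonneg (m : ℝ)
      have h2 : 4 / (m : ℝ) ≤ 16 * (√((m : ℝ) + 1) - √m) := by
        rw [div_le_iff₀ (by linarith)]
        have hprod : (√((m : ℝ) + 1) - √m) * (√((m : ℝ) + 1) + √m) = 1 := by nlinarith
        have h3 : √((m : ℝ) + 1) + √m ≤ 4 * m := by linarith
        have h4 : 0 ≤ √((m : ℝ) + 1) - √m := by linarith
        nlinarith [mul_le_mul_of_nonneg_left h3 h4]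
      push_cast
      linarith

lemma exists_momentBound_le : ∃ C : ℝ, 0 < C ∧ ∀ n : ℕ, 0 < n → momentBound n ≤ C * √n := by
  refine ⟨Real.exp (1 / 4 + 1024 ^ 2), Real.exp_pos _, fun n hn => ?_⟩
  set m := Nat.log 2 n with hm
  have hn1 : 2 ^ m ≤ n := Nat.pow_log_le_self 2 hn.ne'
  have hn2 : n ≤ 2 ^ (m + 1) := (Nat.lt_pow_succ_log_self (by norm_num) n).le
  have h1 : momentBound n ≤ Real.exp (64 * (16 * √((m + 1 : ℕ) : ℝ))) := by
    calc momentBound n ≤ ∏ p ∈ n.primesBelow, Real.exp (64 * (1 / (p : ℝ))) := by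
          refine prod_le_prod (fun p _ => by positivity) fun p _ => ?_
          have := Real.add_one_le_exp (64 * (1 / (p : ℝ)))
          rw [mul_one_div] at this ⊢
          linarith
      _ = Real.exp (64 * ∑ p ∈ n.primesBelow, 1 / (p : ℝ)) := by
          rw [← Real.exp_sum, mul_sum]
      _ ≤ Real.exp (64 * (16 * √((m + 1 : ℕ) : ℝ))) := by
          gcongr
          refine le_trans ?_ (sum_inv_primesBelow_two_pow_le (m + 1))
          exact sum_le_sum_of_subset_of_nonneg (Nat.primesBelow_mono hn2) fun _ _ _ => by positivity
  refine h1.trans ?_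
  have h2 : Real.exp ((m : ℝ) / 4) ≤ √n := by
    apply Real.le_sqrt_of_sq_le
    have he : Real.exp (1 / 2) ≤ 2 := by
      have h := Real.exp_one_lt_d9
      have h3 : Real.exp (1 / 2) ^ 2 = Real.exp 1 := by rw [← Real.exp_nat_mul]; norm_num
      have h4 := Real.exp_pos (1 / 2 : ℝ)
      nlinarith
    calc Real.exp ((m : ℝ) / 4) ^ 2 = Real.exp (1 / 2) ^ m := by
          rw [← Real.exp_nat_mul, ← Real.exp_nat_mul]
          congr 1
          push_cast
          ring
      _ ≤ 2 ^ m := by gcongr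
      _ ≤ n := by exact_mod_cast hn1
  calc Real.exp (64 * (16 * √((m + 1 : ℕ) : ℝ)))
      ≤ Real.exp ((1 / 4 + 1024 ^ 2) + (m : ℝ) / 4) := by
        gcongr
        have h3 := Real.sq_sqrt (show (0 : ℝ) ≤ ((m + 1 : ℕ) : ℝ) by positivity)
        push_cast at h3 ⊢
        nlinarith [sq_nonneg (√((m : ℝ) + 1) - 2048)]
    _ = Real.exp (1 / 4 + 1024 ^ 2) * Real.exp ((m : ℝ) / 4) := Real.exp_add _ _
    _ ≤ _ := by gcongr

lemma sqrt_div_sq_le {u : ℝ} (hu : 1 ≤ u) :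
    √(u + 1) / u ^ 2 ≤ 8 / √u - 8 / √(u + 1) := by
  have hs2 := Real.sq_sqrt (show 0 ≤ u by linarith)
  have ht2 := Real.sq_sqrt (show 0 ≤ u + 1 by linarith)
  have hs1 : 1 ≤ √u := Real.one_le_sqrt.mpr hu
  have ht1 : 1 ≤ √(u + 1) := Real.one_le_sqrt.mpr (by linarith)
  set s := √u
  set t := √(u + 1)
  have hts : t ≤ 2 * s := by nlinarith
  have hprod : (t - s) * (t + s) = 1 := by nlinarith
  have hdiff : 8 / s - 8 / t = 8 * (t - s) / (s * t) := by field_simp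
  rw [hdiff, ← hs2, div_le_div_iff₀ (by positivity) (by positivity)]
  have h0 : 0 ≤ t - s := by nlinarith
  have h1 : t ^ 2 * (t + s) ≤ 8 * s ^ 3 := by
    have h2 : t ^ 2 ≤ 2 * s ^ 2 := by nlinarith
    nlinarith [mul_nonneg (sq_nonneg s) (by linarith : 0 ≤ 2 * s - t), mul_nonneg
      (by linarith : 0 ≤ 2 * s ^ 2 - t ^ 2) (by linarith : 0 ≤ t + s), pow_pos (by linarith : 0 < s) 3]
  have h3 : t ^ 2 ≤ 8 * s ^ 3 * (t - s) := by
    nlinarith [mul_le_mul_of_nonneg_right h1 h0]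
  nlinarith [mul_le_mul_of_nonneg_right h3 (by linarith : 0 ≤ s)]

/-- The distorted mass of the classes involving a prime at least `y` is `O(1 / √y)`. -/
lemma exists_sum_momentBound_le : ∃ C : ℝ, 0 < C ∧ ∀ y N : ℕ, 2 ≤ y → y ≤ N →
    ∑ p ∈ (Ico y N).filter Nat.Prime, momentBound p / ((p : ℝ) - 1) ^ 2 ≤ C / √y := by
  obtain ⟨C, hC, hCb⟩ := exists_momentBound_le
  refine ⟨16 * C, by positivity, fun y N hy hN => ?_⟩
  have hy' : (2 : ℝ) ≤ y := by exact_mod_cast hy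
  have htel : ∑ n ∈ Ico y N, √(n : ℝ) / ((n : ℝ) - 1) ^ 2 ≤
      8 / √((y : ℝ) - 1) - 8 / √((N : ℝ) - 1) := by
    induction N, hN using Nat.le_induction with
    | base => simp
    | succ n hn ih =>
      rw [sum_Ico_succ_top hn]
      have h1 : (1 : ℝ) ≤ (n : ℝ) - 1 := by
        have : (2 : ℝ) ≤ n := by exact_mod_cast hy.trans hn
        linarith
      have h2 := sqrt_div_sq_le h1
      rw [sub_add_cancel] at h2
      push_cast
      rw [add_sub_cancel_right]
      linarith
  have hN0 : 0 ≤ 8 / √((N : ℝ) - 1) := by positivity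
  have hy0 : 8 / √((y : ℝ) - 1) ≤ 16 / √(y : ℝ) := by
    have h1 : √(y : ℝ) ≤ 2 * √((y : ℝ) - 1) := by
      have h4 : (2 : ℝ) = √4 := by rw [show (4 : ℝ) = 2 ^ 2 by norm_num, Real.sqrt_sq (by norm_num)]
      rw [h4, ← Real.sqrt_mul (by norm_num)]
      exact Real.sqrt_le_sqrt (by linarith)
    have h2 : 0 < √((y : ℝ) - 1) := Real.sqrt_pos.mpr (by linarith)
    rw [div_le_div_iff₀ h2 (by positivity)]
    linarith
  calc ∑ p ∈ (Ico y N).filter Nat.Prime, momentBound p / ((p : ℝ) - 1) ^ 2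
      ≤ ∑ p ∈ (Ico y N).filter Nat.Prime, C * (√(p : ℝ) / ((p : ℝ) - 1) ^ 2) := by
        refine sum_le_sum fun p hp => ?_
        rw [← mul_div_assoc]
        gcongr
        exact hCb p (mem_filter.mp hp).2.pos
    _ ≤ ∑ p ∈ Ico y N, C * (√(p : ℝ) / ((p : ℝ) - 1) ^ 2) :=
        sum_le_sum_of_subset_of_nonneg (filter_subset _ _) fun _ _ _ => by positivity
    _ = C * ∑ p ∈ Ico y N, √(p : ℝ) / ((p : ℝ) - 1) ^ 2 := by rw [mul_sum]
    _ ≤ C * (16 / √(y : ℝ)) := by gcongr; linarith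
    _ = 16 * C / √y := by ring

/-- Rankin's bound for the sum of the reciprocals of smooth numbers exceeding `q`. -/
lemma sum_inv_smoothNumbers_le (y : ℕ) {q σ : ℝ} (hq : 0 < q) (hσ0 : 0 ≤ σ) (hσ : σ ≤ 1 / 4)
    (E : Finset ℕ) (hE : ∀ d ∈ E, q ≤ d ∧ d ∈ Nat.smoothNumbers y) :
    ∑ d ∈ E, 1 / (d : ℝ) ≤
      q ^ (-σ) * Real.exp (3 * (y : ℝ) ^ σ * ∑ p ∈ y.primesBelow, 1 / (p : ℝ)) := by
  let f : ℕ →*₀ ℝ :=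
    { toFun := fun n => (n : ℝ) ^ (σ - 1)
      map_zero' := by
        rw [Nat.cast_zero, Real.zero_rpow (by linarith)]
      map_one' := by simp
      map_mul' := fun m n => by
        push_cast
        exact Real.mul_rpow (Nat.cast_nonneg m) (Nat.cast_nonneg n) }
  have hf : ∀ n : ℕ, f n = (n : ℝ) ^ (σ - 1) := fun n => rfl
  have hf0 : ∀ n : ℕ, 0 ≤ f n := fun n => Real.rpow_nonneg (Nat.cast_nonneg n) _
  -- `2 ^ (3 / 4) ≥ 3 / 2`, so the Euler factors are bounded.
  have hfp : ∀ p : ℕ, p.Prime → f p ≤ 2 / 3 := by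
    intro p hp
    have h2 : (2 : ℝ) ≤ p := by exact_mod_cast hp.two_le
    have h34 : (3 / 2 : ℝ) ≤ (2 : ℝ) ^ (3 / 4 : ℝ) := by
      have h1 : ((3 / 2 : ℝ) ^ (4 : ℕ)) ^ (1 / 4 : ℝ) ≤ ((2 : ℝ) ^ (3 : ℕ)) ^ (1 / 4 : ℝ) := by
        gcongr
        norm_num
      rw [← Real.rpow_natCast, ← Real.rpow_natCast, ← Real.rpow_mul (by norm_num),
        ← Real.rpow_mul (by norm_num)] at h1
      norm_num at h1 ⊢
      exact h1
    calc f p = (p : ℝ) ^ (σ - 1) := rfl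
      _ ≤ (p : ℝ) ^ (-(3 / 4) : ℝ) :=
          Real.rpow_le_rpow_of_exponent_le (by linarith) (by linarith)
      _ ≤ (2 : ℝ) ^ (-(3 / 4) : ℝ) :=
          Real.rpow_le_rpow_of_nonpos (by norm_num) h2 (by norm_num)
      _ = ((2 : ℝ) ^ (3 / 4 : ℝ))⁻¹ := Real.rpow_neg (by norm_num) _
      _ ≤ (3 / 2 : ℝ)⁻¹ := inv_anti₀ (by norm_num) h34
      _ = 2 / 3 := by norm_num
  have hlt : ∀ {p : ℕ}, p.Prime → ‖f p‖ < 1 := fun {p} hp => by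
    rw [Real.norm_of_nonneg (hf0 p)]
    linarith [hfp p hp]
  obtain ⟨-, hsum⟩ :=
    EulerProduct.summable_and_hasSum_smoothNumbers_prod_primesBelow_geometric (f := f.toMonoidHom)
      hlt y
  have hsumE : ∑ d ∈ E, f d ≤ ∏ p ∈ y.primesBelow, (1 - f p)⁻¹ := by
    have h1 := sum_le_hasSum (E.subtype (· ∈ Nat.smoothNumbers y)) (fun d _ => hf0 d) hsum
    refine le_trans (le_of_eq ?_) h1
    rw [sum_subtype_eq_sum_filter, filter_true_of_mem fun d hd => (hE d hd).2]
  have hprod : ∏ p ∈ y.primesBelow, (1 - f p)⁻¹ ≤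
      Real.exp (3 * (y : ℝ) ^ σ * ∑ p ∈ y.primesBelow, 1 / (p : ℝ)) := by
    rw [mul_sum, Real.exp_sum]
    refine prod_le_prod (fun p hp => inv_nonneg.mpr ?_) fun p hp => ?_
    · linarith [hfp p (Nat.prime_of_mem_primesBelow hp)]
    · have hpp := Nat.prime_of_mem_primesBelow hp
      have h1 := hfp p hpp
      have h0 := hf0 p
      have hp0 : (0 : ℝ) < p := by exact_mod_cast hpp.pos
      have h2 : f p ≤ (y : ℝ) ^ σ * (1 / p) := by
        rw [hf, Real.rpow_sub_one hp0.ne', mul_one_div]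
        gcongr
        exact_mod_cast (Nat.lt_of_mem_primesBelow hp).le
      calc (1 - f p)⁻¹ ≤ 1 + 3 * f p := by
            rw [inv_le_iff_one_le_mul₀ (by linarith)]
            nlinarith
        _ ≤ Real.exp (3 * f p) := by linarith [Real.add_one_le_exp (3 * f p)]
        _ ≤ Real.exp (3 * (y : ℝ) ^ σ * (1 / p)) := by
            rw [mul_assoc]
            gcongr
  calc ∑ d ∈ E, 1 / (d : ℝ) ≤ ∑ d ∈ E, q ^ (-σ) * f d := by
        refine sum_le_sum fun d hd => ?_
        have hqd := (hE d hd).1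
        have hd0 : (0 : ℝ) < d := hq.trans_le hqd
        calc 1 / (d : ℝ) = (d : ℝ) ^ (-σ) * f d := by
              rw [hf, ← Real.rpow_add hd0, show -σ + (σ - 1) = -1 by ring, Real.rpow_neg_one,
                one_div]
          _ ≤ q ^ (-σ) * f d :=
              mul_le_mul_of_nonneg_right (Real.rpow_le_rpow_of_nonpos hq hqd (by linarith)) (hf0 d)
    _ = q ^ (-σ) * ∑ d ∈ E, f d := by rw [mul_sum]
    _ ≤ _ := by gcongr; exact hsumE.trans hprod

/-! ### The bound for the moduli -/

lemma log_natCast_add_one_bounds {j : ℕ} (hj : 0 < j) :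
    0 < Real.log ((j : ℝ) + 1) ∧ Real.log ((j : ℝ) + 1) ≤ j := by
  have hj1 : (1 : ℝ) ≤ j := by exact_mod_cast hj
  refine ⟨Real.log_pos (by linarith), ?_⟩
  have := Real.log_le_sub_one_of_pos (show (0 : ℝ) < (j : ℝ) + 1 by linarith)
  linarith

/-- The choice `y = 4 ^ (b * j)`, `σ = log (j + 1) / (4 b j)` in Rankin's bound: then
`y ^ σ ≤ √(j + 1)`, so that the Euler product contributes only `exp (O(j))`. -/
lemma sum_inv_smoothNumbers_lt {b j : ℕ} (hb : 0 < b) (hj : 0 < j) {q : ℝ}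
    (hq : Real.exp (4 * b * (96 * b + 2) * (j : ℝ) ^ 2 / Real.log ((j : ℝ) + 1)) < q)
    (E : Finset ℕ) (hE : ∀ d ∈ E, q ≤ d ∧ d ∈ Nat.smoothNumbers (2 ^ (2 * b * j))) :
    ∑ d ∈ E, 1 / (d : ℝ) < (1 / 2) ^ j := by
  obtain ⟨hl0, hlj⟩ := log_natCast_add_one_bounds hj
  have hj1 : (1 : ℝ) ≤ j := by exact_mod_cast hj
  have hb1 : (1 : ℝ) ≤ b := by exact_mod_cast hb
  set l := Real.log ((j : ℝ) + 1) with hl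
  set σ : ℝ := l / (4 * b * j) with hσ
  have hσ0 : 0 ≤ σ := by positivity
  have hσ4 : σ ≤ 1 / 4 := by
    rw [hσ, div_le_div_iff₀ (by positivity) (by norm_num)]
    nlinarith
  have hq0 : 0 < q := (Real.exp_pos _).trans hq
  have hqσ : q ^ (-σ) ≤ Real.exp (-((96 * b + 2) * j)) := by
    have h1 : Real.exp (-((96 * b + 2) * j)) =
        Real.exp (4 * b * (96 * b + 2) * (j : ℝ) ^ 2 / l) ^ (-σ) := by
      rw [← Real.exp_mul, hσ]
      congr 1
      field_simp
    rw [h1]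
    exact Real.rpow_le_rpow_of_nonpos (Real.exp_pos _) hq.le (by linarith)
  have hyσ : (((2 ^ (2 * b * j) : ℕ)) : ℝ) ^ σ ≤ √((j : ℝ) + 1) := by
    have hlog2 : Real.log 2 ≤ 1 := by linarith [Real.log_two_lt_d9]
    rw [Real.sqrt_eq_rpow, Real.rpow_def_of_pos (by positivity), Real.rpow_def_of_pos (by positivity),
      ← hl]
    refine Real.exp_le_exp.mpr ?_
    push_cast
    rw [Real.log_pow, hσ]
    push_cast
    have h2 : 2 * (b : ℝ) * j * Real.log 2 * (l / (4 * b * j)) = Real.log 2 * l / 2 := by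
      field_simp
      ring
    rw [h2]
    nlinarith
  have hS := sum_inv_primesBelow_two_pow_le (2 * b * j)
  have hmain : 3 * (((2 ^ (2 * b * j) : ℕ)) : ℝ) ^ σ *
      ∑ p ∈ Nat.primesBelow (2 ^ (2 * b * j)), 1 / (p : ℝ) ≤ 96 * b * j := by
    calc _ ≤ 3 * √((j : ℝ) + 1) * (16 * √((2 * b * j : ℕ) : ℝ)) := by gcongr
      _ = 48 * (√((j : ℝ) + 1) * √((2 * b * j : ℕ) : ℝ)) := by ring
      _ = 48 * √(((j : ℝ) + 1) * (2 * b * j : ℕ)) := by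
        rw [Real.sqrt_mul (by positivity)]
      _ ≤ 48 * √((2 * b * j) ^ 2) := by
        gcongr
        push_cast
        have : (j : ℝ) + 1 ≤ 2 * b * j := by nlinarith
        rw [sq]
        gcongr
      _ = 96 * b * j := by
        rw [Real.sqrt_sq (by positivity)]
        ring
  calc ∑ d ∈ E, 1 / (d : ℝ) ≤ _ := sum_inv_smoothNumbers_le _ hq0 hσ0 hσ4 E hE
    _ ≤ Real.exp (-((96 * b + 2) * j)) * Real.exp (96 * b * j) := by gcongr
    _ = Real.exp (-2) ^ j := by
      rw [← Real.exp_add, ← Real.exp_nat_mul]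
      congr 1
      ring
    _ < (1 / 2) ^ j := by
      have h2 : Real.exp (-2) < 1 / 2 := by
        rw [Real.exp_neg, one_div]
        refine inv_strictAnti₀ (by norm_num) ?_
        linarith [Real.add_one_lt_exp (show (2 : ℝ) ≠ 0 by norm_num)]
      exact pow_lt_pow_left₀ h2 (Real.exp_pos _).le hj.ne'

/-- If residue classes with moduli in `D` cover `ℤ`, while those with modulus less than `q` do not,
and there are `j - 1` of the latter, then `q ≤ exp (c j ^ 2 / log (j + 1))`. -/
lemma exists_modulus_bound : ∃ c : ℝ, 0 < c ∧ ∀ (D : Finset ℕ) (a : ℕ → ℤ), (∀ d ∈ D, 0 < d) →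
    (∀ x, x ∈ covered D a) → ∀ (j q : ℕ) (x₀ : ℤ), (D.filter (· < q)).card + 1 = j →
    x₀ ∉ covered (D.filter (· < q)) a →
    (q : ℝ) ≤ Real.exp (c * (j : ℝ) ^ 2 / Real.log ((j : ℝ) + 1)) := by
  obtain ⟨C, hC, hCb⟩ := exists_sum_momentBound_le
  obtain ⟨r, hr⟩ := pow_unbounded_of_one_lt C (show (1 : ℝ) < 2 by norm_num)
  set b := r + 1 with hb
  refine ⟨4 * b * (96 * b + 2), by positivity, fun D a hD hcov j q x₀ hcard hx₀ => ?_⟩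
  by_contra! hq
  have hj : 0 < j := by omega
  set Q := ∏ d ∈ D, d with hQ
  have hQpos : 0 < Q := prod_pos hD
  set y := 2 ^ (2 * b * j) with hy
  have hy2 : 2 ≤ y := by
    have : 1 ≤ 2 * b * j := Nat.mul_pos (by omega) hj
    calc 2 = 2 ^ 1 := rfl
      _ ≤ y := Nat.pow_le_pow_right (by norm_num) this
  have h1 := le_sum_of_covered hQpos D (fun d hd => dvd_prod_of_mem (fun d => d) hd) a hcov y q x₀ hx₀
  have h2 := sum_inv_smoothNumbers_lt (b := b) (by omega) hj hq
    (D.filter fun d => q ≤ d ∧ d ∈ Nat.smoothNumbers y) (fun d hd => by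
      obtain ⟨-, h, h'⟩ := mem_filter.mp hd
      exact ⟨by exact_mod_cast h, h'⟩)
  have h3 := hCb y (Q + 1 + y) hy2 (by omega)
  have h4 : C / √(y : ℝ) ≤ (1 / 2) ^ j := by
    have hsq : √(y : ℝ) = 2 ^ (b * j) := by
      have : (y : ℝ) = (2 ^ (b * j)) ^ 2 := by
        rw [hy, ← pow_mul]
        push_cast
        congr 1
        ring
      rw [this, Real.sqrt_sq (by positivity)]
    have h5 : (2 : ℝ) ^ r * 2 ^ j ≤ 2 ^ (b * j) := by
      rw [← pow_add]
      refine pow_le_pow_right₀ (by norm_num) ?_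
      rw [hb, add_mul, one_mul]
      exact Nat.add_le_add_right (Nat.le_mul_of_pos_right r hj) j
    rw [hsq, one_div, inv_pow, div_le_iff₀ (by positivity), ← div_eq_inv_mul,
      le_div_iff₀ (by positivity)]
    refine le_trans ?_ h5
    gcongr
  have h6 : (1 / 2 : ℝ) ^ (D.filter (· < q)).card = 2 * (1 / 2) ^ j := by
    rw [← hcard, pow_succ]
    ring
  linarith

/-- A covering system with distinct moduli, in terms of its set of moduli. -/
lemma exists_residues (C : Finset ArithProg) (hC : HasDistinctModuli C) :
    ∃ a : ℕ → ℤ, ∀ A ∈ C, ∀ x : ℤ, x ∈ A.toSet ↔ (A.modulus : ℤ) ∣ x - a A.modulus := by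
  classical
  have h1 : ∀ d : ℕ, ∃ r : ℤ, ∀ A ∈ C, A.modulus = d → ((r : ℤ) : ZMod A.modulus) = A.residue := by
    intro d
    by_cases h : ∃ A ∈ C, A.modulus = d
    · obtain ⟨A, hA, hAd⟩ := h
      obtain ⟨r, hr⟩ := ZMod.intCast_surjective A.residue
      refine ⟨r, fun B hB hBd => ?_⟩
      obtain rfl := hC A hA B hB (hAd.trans hBd.symm)
      exact hr
    · exact ⟨0, fun A hA hAd => absurd ⟨A, hA, hAd⟩ h⟩
  choose a ha using h1
  refine ⟨a, fun A hA x => ?_⟩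
  rw [ArithProg.toSet, Set.mem_ofPred_eq, ← ha _ A hA rfl, eq_comm,
    ZMod.intCast_eq_intCast_iff_dvd_sub]

lemma isCoveringSystem_iff {C : Finset ArithProg} :
    IsCoveringSystem C ↔ ∀ x : ℤ, ∃ A ∈ C, x ∈ A.toSet := by
  simp [IsCoveringSystem, Set.eq_univ_iff_forall]

/-- The bound holds as soon as the progressions with modulus less than `q` do not cover `ℤ`;
minimality is only needed for that. -/
lemma exists_jthSmallestModulus_bound : ∃ c : ℝ, 0 < c ∧ ∀ C : Finset ArithProg,
    IsCoveringSystem C → HasDistinctModuli C → ∀ j q : ℕ, IsJthSmallestModulus C j q →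
    ¬ IsCoveringSystem (C.filter fun A => A.modulus < q) →
    (q : ℝ) ≤ Real.exp (c * (j : ℝ) ^ 2 / Real.log ((j : ℝ) + 1)) := by
  obtain ⟨c, hc, hbound⟩ := exists_modulus_bound
  refine ⟨c, hc, fun C hcov hdist j q hq hnot => ?_⟩
  obtain ⟨a, ha⟩ := exists_residues C hdist
  rw [isCoveringSystem_iff] at hcov hnot
  push Not at hnot
  obtain ⟨x₀, hx₀⟩ := hnot
  refine hbound (moduli C) a (fun d hd => ?_) (fun x => ?_) j q x₀ ?_ ?_
  · obtain ⟨A, -, rfl⟩ := mem_image.mp hd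
    exact A.modulus_pos
  · obtain ⟨A, hA, hx⟩ := hcov x
    exact ⟨A.modulus, mem_image_of_mem _ hA, (ha A hA x).mp hx⟩
  · have hle : (moduli C).filter (· ≤ q) = insert q ((moduli C).filter (· < q)) := by
      ext d
      simp only [mem_filter, mem_insert]
      constructor
      · rintro ⟨h1, h2⟩
        rcases h2.eq_or_lt with h | h
        · exact Or.inl h
        · exact Or.inr ⟨h1, h⟩
      · rintro (rfl | ⟨h1, h2⟩)
        · exact ⟨hq.1, le_rfl⟩
        · exact ⟨h1, h2.le⟩
    rw [← hq.2, hle, card_insert_of_notMem (by simp)]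
  · rintro ⟨d, hd, hdx⟩
    obtain ⟨hdC, hdq⟩ := mem_filter.mp hd
    obtain ⟨A, hA, rfl⟩ := mem_image.mp hdC
    exact hx₀ A (mem_filter.mpr ⟨hA, hdq⟩) ((ha A hA x₀).mpr hdx)

theorem theorem1 :
    ∃ c : ℝ, 0 < c ∧
      (∀ C : Finset ArithProg, IsMinimalCoveringSystem C → HasDistinctModuli C →
        ∀ j q : ℕ, IsJthSmallestModulus C j q →
          (q : ℝ) ≤ Real.exp (c * (j : ℝ) ^ 2 / Real.log ((j : ℝ) + 1))) ∧
      (∀ C : Finset ArithProg, IsCoveringSystem C → HasDistinctModuli C →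
        ∀ q : ℕ, IsJthSmallestModulus C 1 q →
          (q : ℝ) ≤ Real.exp (c / Real.log 2)) := by
  obtain ⟨c, hc, hbound⟩ := exists_jthSmallestModulus_bound
  refine ⟨c, hc, fun C hC hdist j q hq => ?_, fun C hC hdist q hq => ?_⟩
  · refine hbound C hC.1 hdist j q hq (hC.2 _ ?_)
    refine (filter_subset _ _).ssubset_of_ne fun heq => ?_
    obtain ⟨A, hA, hAq⟩ := mem_image.mp hq.1
    have := (filter_eq_self.mp heq) A hA
    omega
  · have h := hbound C hC hdist 1 q hq ?_
    · norm_num at h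
      exact h
    · -- No modulus is less than `q`, so the progressions in question form the empty family.
      rw [isCoveringSystem_iff]
      intro hcov
      obtain ⟨A, hA, -⟩ := hcov 0
      obtain ⟨hAC, hAq⟩ := mem_filter.mp hA
      obtain ⟨d, hd⟩ := card_eq_one.mp hq.2
      have h1 : A.modulus ∈ (moduli C).filter (fun d => d ≤ q) :=
        mem_filter.mpr ⟨mem_image_of_mem _ hAC, hAq.le⟩
      have h2 : q ∈ (moduli C).filter (fun d => d ≤ q) := mem_filter.mpr ⟨hq.1, le_rfl⟩
      rw [hd, mem_singleton] at h1 h2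
      omega
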